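/- Let $\mathbb B^2=\{z\in\mathbb C^2:\|z\|<1\}$ be the Euclidean unit ball. A normal Loewner chain on $\mathbb B^2$ is a family $(f_t)_{t\ge 0}$ of univalent (that is, holomorphic and injective) maps $f_t:\mathbb B^2\to\mathbb C^2$ such that $f_s(\mathbb B^2)\subset f_t(\mathbb B^2)$ for $0\le s\le t$, $f_t(0)=0$ and $d(f_t)_0=e^t\,\mathrm{id}$ for all $t\ge 0$, and such that $\{e^{-t}f_t\}_{t\ge 0}$ is a normal family in $\mathbb B^2$ (every sequence of its members has a subsequence converging uniformly on compact subsets of $\mathbb B^2$). Let $S^0(\mathbb B^2)$ be the set of all maps $f:\mathbb B^2\to\mathbb C^2$ for which there is a normal Loewner chain $(f_t)_{t\ge 0}$ on $\mathbb B^2$ with $f_0=f$. Let $f=(f_1,f_2)\in S^0(\mathbb B^2)$, with first component $f_1(z)=z_1+\sum_{\alpha\in\mathbb N^2,\,|\alpha|\ge 2}a^1_\alpha z^\alpha$. Then the coefficient $a^1_{0,2}=\frac12\frac{\partial^2 f_1}{\partial z_2^2}(0)$ satisfies $$|a^1_{0,2}|\le\frac{3\sqrt3}{2}.$$ This bound is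 sharp: the shear $\Phi(z_1,z_2)=\left(z_1+\frac{3\sqrt3}{2}z_2^2,\;z_2\right)$, $(z_1,z_2)\in\mathbb B^2$, belongs to $S^0(\mathbb B^2)$, and its coefficient $a^1_{0,2}$ equals $\frac{3\sqrt3}{2}$. -/

import Mathlib

open Filter Topology

namespace Loewner

/-- The space `ℂⁿ` with its Euclidean (Hermitian) norm. -/
abbrev Cn (n : ℕ) : Type := EuclideanSpace ℂ (Fin n)

/-- The open Euclidean unit ball `𝔹ⁿ` of `ℂⁿ`. A map on `𝔹ⁿ` is represented by a total function
on `ℂⁿ`, of which only the values on `𝔹ⁿ` are ever used. -/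
def unitBall (n : ℕ) : Set (Cn n) := Metric.ball 0 1

/-- `f` is univalent on `𝔹ⁿ`: holomorphic and injective there. -/
def IsUnivalent {n : ℕ} (f : Cn n → Cn n) : Prop :=
  DifferentiableOn ℂ f (unitBall n) ∧ Set.InjOn f (unitBall n)

/-- The family `(g t)`, `t ≥ 0`, is normal in `𝔹ⁿ`: each sequence of its members has a subsequence
that converges uniformly on compact subsets of `𝔹ⁿ`. -/
def IsNormalFamily {n : ℕ} (g : ℝ → Cn n → Cn n) : Prop :=
  ∀ u : ℕ → ℝ, (∀ k, 0 ≤ u k) →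
    ∃ φ : ℕ → ℕ, StrictMono φ ∧ ∃ h : Cn n → Cn n,
      ∀ K : Set (Cn n), K ⊆ unitBall n → IsCompact K →
        TendstoUniformlyOn (fun k => g (u (φ k))) h atTop K

/-- Normalized Loewner chains `(F t)`, `t ≥ 0`, on `𝔹ⁿ`. The values `F t` for `t < 0` play no
role. -/
structure IsNormalizedLoewnerChain {n : ℕ} (F : ℝ → Cn n → Cn n) : Prop where
  univalent : ∀ t, 0 ≤ t → IsUnivalent (F t)
  image_subset : ∀ s t, 0 ≤ s → s ≤ t → F s '' unitBall n ⊆ F t '' unitBall n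
  map_zero : ∀ t, 0 ≤ t → F t 0 = 0
  fderiv_zero : ∀ t, 0 ≤ t →
    fderiv ℂ (F t) 0 = (Real.exp t : ℂ) • ContinuousLinearMap.id ℂ (Cn n)

/-- Normal Loewner chains: normalized ones for which `(e⁻ᵗ F t)`, `t ≥ 0`, is normal in `𝔹ⁿ`. -/
structure IsNormalLoewnerChain {n : ℕ} (F : ℝ → Cn n → Cn n) : Prop
    extends IsNormalizedLoewnerChain F where
  normal : IsNormalFamily (fun t z => (Real.exp (-t) : ℂ) • F t z)

/-- The class `S⁰(𝔹ⁿ)` of maps with parametric representation: the initial elements of normal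
Loewner chains. -/
def S0 (n : ℕ) : Set (Cn n → Cn n) :=
  {f | ∃ F : ℝ → Cn n → Cn n, IsNormalLoewnerChain F ∧ F 0 = f}

/-- The Taylor coefficient at `0` of `z₁^p z₂^q` in the `j`-th component of `f`, that is
`1 / (p! q!) · ∂^{p+q} f_j / ∂z₁^p ∂z₂^q (0)`. Components are numbered from `0` here. -/
noncomputable def taylorCoeff (f : Cn 2 → Cn 2) (j : Fin 2) (p q : ℕ) : ℂ :=
  iteratedDeriv p (fun z : ℂ => iteratedDeriv q (fun w : ℂ => f !₂[z, w] j) 0) 0 /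
    ((p.factorial : ℂ) * (q.factorial : ℂ))

/-- On `𝔹²`, the first component of `f` is `z₁ + ∑_{|α| ≥ 2} a_α z^α`. -/
def HasFirstComponent (f : Cn 2 → Cn 2) (a : ℕ × ℕ → ℂ) : Prop :=
  ∀ z ∈ unitBall 2,
    HasSum (fun α : {α : ℕ × ℕ // 2 ≤ α.1 + α.2} => a α.1 * (z 0 ^ α.1.1 * z 1 ^ α.1.2))
      (f z 0 - z 0)

/-- The shear `Φ(z₁, z₂) = (z₁ + (3√3/2) z₂², z₂)`. -/
noncomputable def shear (z : Cn 2) : Cn 2 :=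
  !₂[z 0 + ((3 * √3 / 2 : ℝ) : ℂ) * z 1 ^ 2, z 1]

end Loewner

/-!
The bound rests on an estimate for a single holomorphic self-map `v` of the ball with `v(0) = 0` and
`dv₀ = λ id`, `0 < λ ≤ 1`: the coefficient `q` of `z₂²` in `v₁` satisfies `|q| ≤ (3√3/2)(1 - λ)`.
By the Schwarz lemma `|⟪z, v(z)⟫| ≤ ‖z‖²`, and averaging over `z = (A e^{2iθ}, b e^{iθ})` leaves
`|λ (|A|² + b²) + q b² Ā| ≤ |A|² + b²`; the phase of `A` is free, and `|A| b²` is at most `2/(3√3)`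
on the unit sphere (`norm_weighted_secondCoeff_le`, `norm_secondCoeff_le_of_self_map`).

In a Loewner chain `f_s = f_t ∘ v` with `λ = e^{s-t}`, and comparing the coefficients `a(t)` of
`z₂²` in the first component gives `a(s) = e^{2(s-t)} a(t) + e^t q`. Along times `0, δ, 2δ, …` the
errors telescope, `e^{-t} a(t)` stays bounded along a sequence by normality, and `δ → 0` gives
`|a(0)| ≤ 3√3/2` (`norm_secondCoeff_zero_le`, `norm_secondCoeff_le_of_chain`). No differential
equation for the chain is needed.

That `v = f_t⁻¹ ∘ f_s` is holomorphic is Osgood's theorem, that an injective holomorphic map of two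
variables has no critical points (`jacobian_ne_zero_of_injOn`). It uses that holomorphic maps of
several variables are smooth (`contDiffOn_of_differentiableOn`).

For sharpness, the dilations `eᵗ Φ` of the shear form a Loewner chain because the maps
`Φ⁻¹(λ Φ(z)) = (λ z₁ + C λ (1 - λ) z₂², λ z₂)`, `C = 3√3/2`, preserve the ball
(`shear_transition_mem`), which reduces to a polynomial inequality in two real variables.
-/

open Filter Topology

namespace Loewner

/-! ### Smoothness of holomorphic maps -/

section Smoothness

variable {E F : Type*} [NormedAddCommGroup E] [NormedSpace ℂ E] [FiniteDimensional ℂ E]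
  [NormedAddCommGroup F] [NormedSpace ℂ F] [CompleteSpace F] [SecondCountableTopology F]

/-- The Cauchy integral over a circle in the direction `e` represents `z ↦ fderiv ℂ f z e`, and can
be differentiated under the integral sign because `fderiv ℂ f` is locally bounded. -/
lemma differentiableAt_fderiv_apply {f : E → F} {U : Set E} (hU : IsOpen U)
    (hf : DifferentiableOn ℂ f U) (e : E) {z₀ : E} (hz₀ : z₀ ∈ U) :
    DifferentiableAt ℂ (fun z => fderiv ℂ f z e) z₀ := by
  borelize E
  have hcont : ContinuousAt f z₀ := (hf.differentiableAt (hU.mem_nhds hz₀)).continuousAt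
  obtain ⟨R, hR, hRU⟩ : ∃ R > 0, ∀ z ∈ Metric.ball z₀ (3 * R), z ∈ U ∧ ‖f z - f z₀‖ ≤ 1 := by
    have h1 : ∀ᶠ z in 𝓝 z₀, z ∈ U ∧ ‖f z - f z₀‖ ≤ 1 := by
      refine (hU.eventually_mem hz₀).and ?_
      filter_upwards [Metric.continuousAt_iff'.1 hcont 1 one_pos] with z hz
      rw [← dist_eq_norm]; exact hz.le
    obtain ⟨ε, hε, h⟩ := Metric.eventually_nhds_iff_ball.1 h1
    exact ⟨ε / 3, by positivity, fun z hz => h z (by rwa [mul_div_cancel₀ _ (by norm_num)] at hz)⟩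
  have hd : ∀ z ∈ Metric.ball z₀ (3 * R), DifferentiableAt ℂ f z := fun z hz =>
    hf.differentiableAt (hU.mem_nhds (hRU z hz).1)
  have hbound : ∀ w ∈ Metric.ball z₀ (2 * R), ‖fderiv ℂ f w‖ ≤ 2 / R := by
    intro w hw
    have hsub : Metric.ball w R ⊆ Metric.ball z₀ (3 * R) :=
      Metric.ball_subset_ball' (by rw [Metric.mem_ball] at hw; linarith)
    refine Complex.norm_fderiv_le_div_of_mapsTo_ball
      (fun z hz => (hd z (hsub hz)).differentiableWithinAt) (fun z hz => ?_) hR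
    rw [Metric.mem_closedBall, dist_eq_norm]
    have h1 := (hRU z (hsub hz)).2
    have h2 := (hRU w (hsub (Metric.mem_ball_self hR))).2
    calc ‖f z - f w‖ = ‖(f z - f z₀) - (f w - f z₀)‖ := by congr 1; abel
      _ ≤ ‖f z - f z₀‖ + ‖f w - f z₀‖ := norm_sub_le _ _
      _ ≤ 2 := by linarith
  set r : ℝ := R / (‖e‖ + 1) with hr_def
  have he : 0 < ‖e‖ + 1 := by positivity
  have hr : 0 < r := by positivity
  have hre : r * ‖e‖ < R := by
    rw [hr_def, div_mul_eq_mul_div, div_lt_iff₀ he]; nlinarith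
  have hmem : ∀ z ∈ Metric.ball z₀ R, ∀ ζ : ℂ, ‖ζ‖ ≤ r → z + ζ • e ∈ Metric.ball z₀ (2 * R) := by
    intro z hz ζ hζ
    rw [Metric.mem_ball, dist_eq_norm] at *
    calc ‖z + ζ • e - z₀‖ = ‖(z - z₀) + ζ • e‖ := by congr 1; abel
      _ ≤ ‖z - z₀‖ + ‖ζ‖ * ‖e‖ := by rw [← norm_smul]; exact norm_add_le _ _
      _ ≤ ‖z - z₀‖ + r * ‖e‖ := by gcongr
      _ < 2 * R := by linarith
  have hsub23 : Metric.ball z₀ (2 * R) ⊆ Metric.ball z₀ (3 * R) :=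
    Metric.ball_subset_ball (by linarith)
  have hcauchy : ∀ z ∈ Metric.ball z₀ R, fderiv ℂ f z e =
      (2 * Real.pi * Complex.I : ℂ)⁻¹ • ∫ θ in (0 : ℝ)..2 * Real.pi,
        (deriv (circleMap 0 r) θ * (circleMap 0 r θ ^ 2)⁻¹) • f (z + circleMap 0 r θ • e) := by
    intro z hz
    have hV : IsOpen ((fun ζ : ℂ => z + ζ • e) ⁻¹' Metric.ball z₀ (3 * R)) :=
      Metric.isOpen_ball.preimage (by fun_prop)
    have key := Complex.two_pi_I_inv_smul_circleIntegral_sub_sq_inv_smul_of_differentiable hV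
      (c := 0) (w₀ := 0) (R := r) (f := fun ζ : ℂ => f (z + ζ • e))
      (fun ζ hζ => hsub23 (hmem z hz ζ (by simpa using hζ)))
      (fun ζ hζ => ((hd _ hζ).comp ζ (by fun_prop)).differentiableWithinAt)
      (Metric.mem_ball_self hr)
    have hder : deriv (fun ζ : ℂ => f (z + ζ • e)) 0 = fderiv ℂ f z e := by
      have hz' : z + (0 : ℂ) • e = z := by simp
      have h1 : HasFDerivAt f (fderiv ℂ f z) (z + (0 : ℂ) • e) := by
        rw [hz']
        exact (hd z (hsub23 (hz' ▸ hmem z hz 0 (by simpa using hr.le)))).hasFDerivAt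
      have h2 : HasDerivAt (fun ζ : ℂ => z + ζ • e) e 0 := by
        simpa using ((hasDerivAt_id (0 : ℂ)).smul_const e).const_add z
      exact (h1.comp_hasDerivAt 0 h2).deriv
    rw [← hder, ← key, circleIntegral]
    simp only [sub_zero, smul_smul]
  have hev : (fun z => fderiv ℂ f z e) =ᶠ[𝓝 z₀] fun z =>
      (2 * Real.pi * Complex.I : ℂ)⁻¹ • ∫ θ in (0 : ℝ)..2 * Real.pi,
        (deriv (circleMap 0 r) θ * (circleMap 0 r θ ^ 2)⁻¹) • f (z + circleMap 0 r θ • e) := by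
    filter_upwards [Metric.ball_mem_nhds z₀ hR] with z hz using hcauchy z hz
  have hnorm : ∀ θ, ‖circleMap 0 r θ‖ = r := fun θ => by simp [abs_of_pos hr]
  have hk : Continuous fun θ : ℝ => deriv (circleMap 0 r) θ * (circleMap 0 r θ ^ 2)⁻¹ := by
    simp only [deriv_circleMap]
    refine ((continuous_circleMap 0 r).mul continuous_const).mul
      (((continuous_circleMap 0 r).pow 2).inv₀ fun θ => ?_)
    have : ‖circleMap 0 r θ‖ ≠ 0 := by rw [hnorm]; exact hr.ne'
    exact pow_ne_zero 2 (norm_ne_zero_iff.1 this)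
  have hFc : ∀ z ∈ Metric.ball z₀ R, Continuous fun θ : ℝ =>
      (deriv (circleMap 0 r) θ * (circleMap 0 r θ ^ 2)⁻¹) • f (z + circleMap 0 r θ • e) := by
    intro z hz
    refine hk.smul (continuous_iff_continuousAt.2 fun θ => ?_)
    refine ContinuousAt.comp (g := f)
      (hd _ (hsub23 (hmem z hz _ (hnorm θ).le))).continuousAt ?_
    exact (continuous_const.add ((continuous_circleMap 0 r).smul continuous_const)).continuousAt
  refine DifferentiableAt.congr_of_eventuallyEq ?_ hev
  refine DifferentiableAt.const_smul ?_ _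
  refine (intervalIntegral.hasFDerivAt_integral_of_dominated_of_fderiv_le (𝕜 := ℂ)
    (F' := fun z θ => (deriv (circleMap 0 r) θ * (circleMap 0 r θ ^ 2)⁻¹) •
      fderiv ℂ f (z + circleMap 0 r θ • e))
    (bound := fun θ => ‖deriv (circleMap 0 r) θ * (circleMap 0 r θ ^ 2)⁻¹‖ * (2 / R))
    (Metric.ball_mem_nhds z₀ hR) ?_ ?_ ?_ ?_ ?_ ?_).differentiableAt
  · filter_upwards [Metric.ball_mem_nhds z₀ hR] with z hz
      using (hFc z hz).aestronglyMeasurable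
  · exact (hFc z₀ (Metric.mem_ball_self hR)).intervalIntegrable _ _
  · refine hk.aestronglyMeasurable.smul (Measurable.aestronglyMeasurable ?_)
    exact (measurable_fderiv ℂ f).comp
      (continuous_const.add ((continuous_circleMap 0 r).smul continuous_const)).measurable
  · refine Eventually.of_forall fun θ _ z hz => ?_
    rw [norm_smul]
    gcongr
    exact hbound _ (hmem z hz _ (hnorm θ).le)
  · exact (hk.norm.mul continuous_const).intervalIntegrable _ _
  · refine Eventually.of_forall fun θ _ z hz => ?_
    have h1 := (hd _ (hsub23 (hmem z hz _ (hnorm θ).le))).hasFDerivAt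
    exact (h1.comp z ((hasFDerivAt_id z).add_const _)).const_smul _

/-- A holomorphic map on an open subset of a finite-dimensional space is smooth. -/
lemma contDiffOn_of_differentiableOn {U : Set E} (hU : IsOpen U) (n : ℕ) {f : E → F}
    (hf : DifferentiableOn ℂ f U) : ContDiffOn ℂ n f U := by
  induction n generalizing f with
  | zero => exact contDiffOn_zero.2 hf.continuousOn
  | succ n ih =>
    push_cast
    rw [contDiffOn_succ_iff_fderiv_of_isOpen hU]
    refine ⟨hf, by simp, contDiffOn_clm_apply.2 fun e => ih fun z hz =>
      (differentiableAt_fderiv_apply hU hf e hz).differentiableWithinAt⟩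

end Smoothness

/-! ### Critical points of injective holomorphic maps -/

lemma eventually_eq_of_hasDerivAt_zero {F : Type*} [NormedAddCommGroup F] [NormedSpace ℂ F]
    {f : ℂ → F} {a : ℂ} (h : ∀ᶠ x in 𝓝 a, HasDerivAt f 0 x) : ∀ᶠ x in 𝓝 a, f x = f a := by
  obtain ⟨r, hr, hball⟩ := Metric.eventually_nhds_iff_ball.1 h
  filter_upwards [Metric.ball_mem_nhds a hr] with x hx
  exact Metric.isOpen_ball.is_const_of_deriv_eq_zero (convex_ball a r).isPreconnected
    (fun y hy => (hball y hy).differentiableAt.differentiableWithinAt)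
    (fun y hy => (hball y hy).deriv) hx (Metric.mem_ball_self hr)

lemma not_injOn_of_eventually_eq {X : Type*} {g : ℂ → X} {V : Set ℂ} (hV : IsOpen V)
    {z : ℂ} (hz : z ∈ V) (h : ∀ᶠ w in 𝓝 z, g w = g z) : ¬ Set.InjOn g V := by
  intro hi
  have h1 : ∀ᶠ w in 𝓝[≠] z, w ≠ z ∧ g w = g z ∧ w ∈ V :=
    (eventually_mem_nhdsWithin (a := z) (s := {z}ᶜ)).and
      ((h.and (hV.eventually_mem hz)).filter_mono nhdsWithin_le_nhds)
  obtain ⟨w, hw, hgw, hwV⟩ := h1.exists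
  exact hw (hi hwV hz hgw)

/-- The inverse of an injective holomorphic function is continuous by the open mapping theorem and
holomorphic off a discrete set, hence holomorphic; the chain rule then excludes a critical point. -/
lemma deriv_ne_zero_of_injOn {g : ℂ → ℂ} {V : Set ℂ} (hV : IsOpen V)
    (hg : DifferentiableOn ℂ g V) (hi : Set.InjOn g V) {z : ℂ} (hz : z ∈ V) : deriv g z ≠ 0 := by
  have hopen : ∀ x ∈ V, ∀ W ∈ 𝓝 x, g '' W ∈ 𝓝 (g x) := by
    intro x hx W hW
    rcases (hg.analyticAt (hV.mem_nhds hx)).eventually_constant_or_nhds_le_map_nhds with h | h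
    · exact absurd hi (not_injOn_of_eventually_eq hV hx h)
    · exact h (image_mem_map hW)
  set G := Function.invFunOn g V with hG
  have hleft : ∀ y ∈ V, G (g y) = y := fun y hy => hi.leftInvOn_invFunOn hy
  have hGcont : ∀ x ∈ V, ContinuousAt G (g x) := by
    intro x hx W hW
    rw [hleft x hx] at hW
    refine mem_map.2 (mem_of_superset (hopen x hx _ (inter_mem hW (hV.mem_nhds hx))) ?_)
    rintro _ ⟨y, ⟨hyW, hyV⟩, rfl⟩
    rw [Set.mem_preimage, hleft y hyV]
    exact hyW
  have hder : ∀ᶠ w in 𝓝[≠] z, deriv g w ≠ 0 := by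
    rcases ((hg.deriv hV).analyticAt
      (hV.mem_nhds hz)).eventually_eq_zero_or_eventually_ne_zero with h | h
    · refine absurd hi (not_injOn_of_eventually_eq hV hz (eventually_eq_of_hasDerivAt_zero ?_))
      filter_upwards [h, hV.mem_nhds hz] with w hw hwV
      rw [← hw]
      exact (hg.differentiableAt (hV.mem_nhds hwV)).hasDerivAt
    · exact h
  have hGdiff : ∀ᶠ y in 𝓝[≠] (g z), DifferentiableAt ℂ G y := by
    rw [eventually_nhdsWithin_iff] at hder ⊢
    filter_upwards [hopen z hz _ (inter_mem hder (hV.mem_nhds hz))]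
    rintro _ ⟨y, ⟨hy, hyV⟩, rfl⟩ hne
    have hyz : y ≠ z := fun h => hne (by simp [h])
    refine (HasDerivAt.of_local_left_inverse (f := g) (f' := deriv g y) (hGcont y hyV) ?_
      (hy hyz) ?_).differentiableAt
    · rw [hleft y hyV]
      exact (hg.differentiableAt (hV.mem_nhds hyV)).hasDerivAt
    · filter_upwards [hopen y hyV V (hV.mem_nhds hyV)]
      rintro _ ⟨x, hx, rfl⟩
      rw [hleft x hx]
  have hGz : DifferentiableAt ℂ G (g z) :=
    (Complex.analyticAt_of_differentiable_on_punctured_nhds_of_continuousAt hGdiff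
      (hGcont z hz)).differentiableAt
  intro h0
  have h1 : HasDerivAt (G ∘ g) (deriv G (g z) * deriv g z) z :=
    hGz.hasDerivAt.comp z (hg.differentiableAt (hV.mem_nhds hz)).hasDerivAt
  have h2 : HasDerivAt (G ∘ g) 1 z :=
    (hasDerivAt_id z).congr_of_eventuallyEq (by
      filter_upwards [hV.mem_nhds hz] with y hy using hleft y hy)
  have := h1.unique h2
  simp [h0] at this

lemma hasStrictFDerivAt_of_differentiableOn {E F : Type*} [NormedAddCommGroup E]
    [NormedSpace ℂ E] [FiniteDimensional ℂ E] [NormedAddCommGroup F] [NormedSpace ℂ F]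
    [CompleteSpace F] [SecondCountableTopology F] {f : E → F} {U : Set E} (hU : IsOpen U)
    (hf : DifferentiableOn ℂ f U) {z : E} (hz : z ∈ U) :
    HasStrictFDerivAt f (fderiv ℂ f z) z :=
  ((contDiffOn_of_differentiableOn hU 1 hf).contDiffAt (hU.mem_nhds hz)).hasStrictFDerivAt
    (by simp)

lemma clm_apply_eq (L : Cn 2 →L[ℂ] ℂ) (v : Cn 2) :
    L v = v 0 * L (EuclideanSpace.single 0 1) + v 1 * L (EuclideanSpace.single 1 1) := by
  have hv : v = v 0 • EuclideanSpace.single (0 : Fin 2) (1 : ℂ) +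
      v 1 • EuclideanSpace.single (1 : Fin 2) (1 : ℂ) := by
    ext i; fin_cases i <;> simp
  conv_lhs => rw [hv]
  simp

lemma exists_complement_functional {L : Cn 2 →L[ℂ] ℂ} (hL : L ≠ 0) :
    ∃ ℓ : Cn 2 →L[ℂ] ℂ, Function.Injective (L.prod ℓ) := by
  have inj : ∀ ℓ : Cn 2 →L[ℂ] ℂ, (∀ v, L v = 0 → ℓ v = 0 → v = 0) →
      Function.Injective (L.prod ℓ) := by
    intro ℓ h
    rw [injective_iff_map_eq_zero]
    intro v hv
    simp only [ContinuousLinearMap.prod_apply, Prod.mk_eq_zero] at hv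
    exact h v hv.1 hv.2
  by_cases h0 : L (EuclideanSpace.single 0 1) = 0
  · have h1 : L (EuclideanSpace.single 1 1) ≠ 0 := by
      intro h1
      exact hL (by ext v; simp [clm_apply_eq L v, h0, h1])
    refine ⟨EuclideanSpace.proj 0, inj _ fun v hv hv0 => ?_⟩
    have hv0 : v 0 = 0 := hv0
    rw [clm_apply_eq, hv0] at hv
    have hv1 : v 1 = 0 := by simpa [h1] using hv
    ext i; fin_cases i <;> simp [hv0, hv1]
  · refine ⟨EuclideanSpace.proj 1, inj _ fun v hv hv1 => ?_⟩
    have hv1 : v 1 = 0 := hv1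
    rw [clm_apply_eq, hv1] at hv
    have hv0 : v 0 = 0 := by simpa [h0] using hv
    ext i; fin_cases i <;> simp [hv0, hv1]

/-- Near a noncritical point `q`, the level set of a holomorphic function `g` of two variables is
a holomorphic curve `c`, with `ℓ` as its parameter, tangent to the kernel of the derivative. -/
lemma exists_level_curve {g : Cn 2 → ℂ} {U : Set (Cn 2)} (hU : IsOpen U)
    (hg : DifferentiableOn ℂ g U) {q : Cn 2} (hq : q ∈ U) (hgq : fderiv ℂ g q ≠ 0) :
    ∃ (c : ℂ → Cn 2) (ℓ : Cn 2 → ℂ), (∀ᶠ x in 𝓝 0, DifferentiableAt ℂ c x) ∧ c 0 = q ∧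
      (∀ᶠ x in 𝓝 0, g (c x) = g q) ∧ Continuous ℓ ∧ ℓ q = 0 ∧
      (∀ᶠ x in 𝓝 0, ℓ (c x) = x) ∧ (∀ᶠ z in 𝓝 q, g z = g q → c (ℓ z) = z) ∧
      ∀ k, fderiv ℂ g q k = 0 → ∃ α : ℂ, k = α • deriv c 0 := by
  obtain ⟨ℓ, hℓ⟩ := exists_complement_functional hgq
  let A : Cn 2 ≃L[ℂ] ℂ × ℂ := (LinearMap.linearEquivOfInjective
    ((fderiv ℂ g q).prod ℓ : Cn 2 →L[ℂ] ℂ × ℂ).toLinearMap hℓ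
    (by simp)).toContinuousLinearEquiv
  have hA : (A : Cn 2 →L[ℂ] ℂ × ℂ) = (fderiv ℂ g q).prod ℓ := by ext v <;> rfl
  let Ψ : Cn 2 → ℂ × ℂ := fun z => (g z, ℓ (z - q))
  have hΨ : ContDiffAt ℂ 1 Ψ q :=
    ((contDiffOn_of_differentiableOn hU 1 hg).contDiffAt (hU.mem_nhds hq)).prodMk
      (ℓ.contDiff.comp (contDiff_id.sub contDiff_const)).contDiffAt
  have hΨ' : HasFDerivAt Ψ (A : Cn 2 →L[ℂ] ℂ × ℂ) q := by
    rw [hA]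
    refine (hg.differentiableAt (hU.mem_nhds hq)).hasFDerivAt.prodMk ?_
    exact ℓ.hasFDerivAt.comp q ((hasFDerivAt_id q).sub_const q)
  have hstrict := hΨ.hasStrictFDerivAt' hΨ' one_ne_zero
  set inv := hstrict.localInverse Ψ A q with hinv
  have hΨq : Ψ q = (g q, 0) := by simp [Ψ]
  have hinvC : ContDiffAt ℂ 1 inv (g q, 0) := hΨq ▸ hΨ.to_localInverse hΨ' one_ne_zero
  have hinvD : HasFDerivAt inv (A.symm : ℂ × ℂ →L[ℂ] Cn 2) (g q, 0) :=
    hΨq ▸ hstrict.to_localInverse.hasFDerivAt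
  have hline : Tendsto (fun x : ℂ => (g q, x)) (𝓝 0) (𝓝 (g q, 0)) :=
    (Continuous.prodMk_right (g q)).tendsto 0
  have hlineD : ∀ x : ℂ, HasDerivAt (fun x : ℂ => (g q, x)) (0, 1) x := fun x =>
    (hasDerivAt_const x (g q)).prodMk (hasDerivAt_id x)
  have hright : ∀ᶠ x in 𝓝 (0 : ℂ), Ψ (inv (g q, x)) = (g q, x) :=
    hline.eventually (hΨq ▸ hstrict.eventually_right_inverse)
  refine ⟨fun x => inv (g q, x), fun z => ℓ (z - q), ?_, ?_, ?_, by fun_prop, by simp, ?_, ?_, ?_⟩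
  · filter_upwards [hline.eventually (hinvC.eventually (by simp))] with x hx
    exact (hx.differentiableAt one_ne_zero).comp x (hlineD x).differentiableAt
  · have := hstrict.localInverse_apply_image
    rwa [hΨq] at this
  · filter_upwards [hright] with x hx using congrArg Prod.fst hx
  · filter_upwards [hright] with x hx using congrArg Prod.snd hx
  · filter_upwards [hstrict.eventually_left_inverse] with z hz hgz
    rw [← hgz]
    exact hz
  · intro k hk
    refine ⟨ℓ k, ?_⟩
    have h1 : deriv (fun x => inv (g q, x)) 0 = A.symm (0, 1) :=
      (hinvD.comp_hasDerivAt 0 (hlineD 0)).deriv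
    have h2 : A k = ℓ k • ((0, 1) : ℂ × ℂ) := by
      have : A k = (fderiv ℂ g q k, ℓ k) := rfl
      rw [this, hk]; simp
    rw [h1, ← map_smul, ← h2, A.symm_apply_apply]

lemma fderiv_component {f : Cn 2 → Cn 2} {q : Cn 2} (hf : DifferentiableAt ℂ f q) (i : Fin 2) :
    HasFDerivAt (fun z => f z i) ((EuclideanSpace.proj i : Cn 2 →L[ℂ] ℂ).comp (fderiv ℂ f q)) q :=
  (EuclideanSpace.proj i : Cn 2 →L[ℂ] ℂ).hasFDerivAt.comp q hf.hasFDerivAt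

/-- An injective holomorphic map of two variables has no point of rank one: on a level curve of one
component, the other component would be an injective function with a critical point. -/
lemma fderiv_eq_zero_of_injOn {f : Cn 2 → Cn 2} {U : Set (Cn 2)} (hU : IsOpen U)
    (hf : DifferentiableOn ℂ f U) (hi : Set.InjOn f U) {q k : Cn 2} (hq : q ∈ U) (hk : k ≠ 0)
    (hfk : fderiv ℂ f q k = 0) : fderiv ℂ f q = 0 := by
  by_contra hne
  have hfd : ∀ z ∈ U, DifferentiableAt ℂ f z := fun z hz => hf.differentiableAt (hU.mem_nhds hz)
  obtain ⟨i, hi0⟩ : ∃ i : Fin 2, fderiv ℂ (fun z => f z i) q ≠ 0 := by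
    by_contra! h
    refine hne (ContinuousLinearMap.ext fun v => ?_)
    ext i
    have h1 := (fderiv_component (hfd q hq) i).fderiv
    rw [h i] at h1
    exact (congrArg (fun L : Cn 2 →L[ℂ] ℂ => L v) h1).symm
  have hgi : ∀ i : Fin 2, DifferentiableOn ℂ (fun z => f z i) U := fun i z hz =>
    (fderiv_component (hfd z hz) i).differentiableAt.differentiableWithinAt
  obtain ⟨c, ℓ, hc, hc0, hgc, hℓ, hℓq, hℓc, -, hker⟩ := exists_level_curve hU (hgi i) hq hi0
  have hcU : ∀ᶠ x in 𝓝 (0 : ℂ), c x ∈ U := by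
    have : ContinuousAt c 0 := hc.self_of_nhds.continuousAt
    exact this.eventually (by rw [hc0]; exact hU.eventually_mem hq)
  obtain ⟨r, hr, hball⟩ := Metric.eventually_nhds_iff_ball.1 (hc.and (hgc.and (hℓc.and hcU)))
  obtain ⟨j, hj⟩ : ∃ j : Fin 2, ∀ m, m = i ∨ m = j := by
    refine ⟨1 - i, fun m => ?_⟩
    fin_cases i <;> fin_cases m <;> simp
  have h1 : deriv (fun x => f (c x) j) 0 ≠ 0 := by
    refine deriv_ne_zero_of_injOn (V := Metric.ball 0 r) Metric.isOpen_ball ?_ ?_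
      (Metric.mem_ball_self hr)
    · intro x hx
      obtain ⟨h1, -, -, h4⟩ := hball x hx
      exact (((hgi j).differentiableAt (hU.mem_nhds h4)).comp x h1).differentiableWithinAt
    · intro x hx y hy hxy
      obtain ⟨-, hx2, hx3, hx4⟩ := hball x hx
      obtain ⟨-, hy2, hy3, hy4⟩ := hball y hy
      have : c x = c y := hi hx4 hy4 (by
        ext m
        rcases hj m with rfl | rfl
        · exact hx2.trans hy2.symm
        · exact hxy)
      rw [← hx3, ← hy3, this]
  obtain ⟨α, hα⟩ := hker k (by
    rw [(fderiv_component (hfd q hq) i).fderiv]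
    simp [hfk])
  have hα0 : α ≠ 0 := by rintro rfl; exact hk (by simpa using hα)
  have h2 : fderiv ℂ f q (deriv c 0) = 0 := by
    rw [hα, map_smul] at hfk
    exact (smul_eq_zero.1 hfk).resolve_left hα0
  apply h1
  have h3 : HasFDerivAt (fun z => f z j)
      ((EuclideanSpace.proj j : Cn 2 →L[ℂ] ℂ).comp (fderiv ℂ f q)) (c 0) := by
    rw [hc0]; exact fderiv_component (hfd q hq) j
  have h4 := h3.comp_hasDerivAt 0 hc.self_of_nhds.hasDerivAt
  have h5 : deriv (fun x => f (c x) j) 0 = _ := h4.deriv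
  rw [h5]
  simp [h2]

/-! ### Osgood's theorem in two variables -/

/-- Hurwitz-type statement: by the maximum principle for the reciprocal, a zero on one slice
persists on the neighbouring slices, so zeros of a holomorphic function of two variables are not isolated. -/
lemma exists_zero_ne_of_zero {J : Cn 2 → ℂ} {U : Set (Cn 2)} (hU : IsOpen U)
    (hJ : DifferentiableOn ℂ J U) {q : Cn 2} (hq : q ∈ U) (h0 : J q = 0) :
    ∃ z ∈ U, z ≠ q ∧ J z = 0 := by
  set e₀ : Cn 2 := EuclideanSpace.single 0 1 with he₀
  set e₁ : Cn 2 := EuclideanSpace.single 1 1 with he₁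
  let p : ℂ → ℂ → Cn 2 := fun η ζ => q + ζ • e₀ + η • e₁
  have hp : Continuous fun x : ℂ × ℂ => p x.1 x.2 := by fun_prop
  have hp0 : p 0 0 = q := by simp [p]
  have hJd : ∀ z ∈ U, DifferentiableAt ℂ J z := fun z hz => hJ.differentiableAt (hU.mem_nhds hz)
  have hslicec : ∀ η, Continuous (p η) := fun η => hp.comp (Continuous.prodMk_right η)
  obtain ⟨r₀, hr₀, hr₀U⟩ : ∃ r > 0, ∀ ζ ∈ Metric.ball (0 : ℂ) r, p 0 ζ ∈ U := by
    refine Metric.eventually_nhds_iff_ball.1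
      ((hslicec 0).continuousAt.eventually (p := fun z => z ∈ U) ?_)
    rw [hp0]
    exact hU.eventually_mem hq
  have hslice : AnalyticAt ℂ (fun ζ => J (p 0 ζ)) 0 := by
    refine DifferentiableOn.analyticAt (s := Metric.ball 0 r₀) (fun ζ hζ => ?_)
      (Metric.ball_mem_nhds 0 hr₀)
    refine ((hJd _ (hr₀U ζ hζ)).comp ζ ?_).differentiableWithinAt
    fun_prop
  rcases hslice.eventually_eq_zero_or_eventually_ne_zero with h | h
  · have h1 : ∀ᶠ ζ in 𝓝[≠] (0 : ℂ), ζ ≠ 0 ∧ J (p 0 ζ) = 0 ∧ ζ ∈ Metric.ball (0 : ℂ) r₀ :=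
      (eventually_mem_nhdsWithin (a := (0 : ℂ)) (s := {0}ᶜ)).and
        ((h.and (Metric.ball_mem_nhds 0 hr₀)).filter_mono nhdsWithin_le_nhds)
    obtain ⟨ζ, hζ, hJζ, hζr⟩ := h1.exists
    refine ⟨p 0 ζ, hr₀U ζ hζr, fun heq => hζ ?_, hJζ⟩
    have := congrArg (fun z : Cn 2 => z 0) heq
    simpa [p, he₀] using this
  rw [eventually_nhdsWithin_iff] at h
  obtain ⟨r₁, hr₁, hne⟩ := Metric.eventually_nhds_iff_ball.1 h
  obtain ⟨r, hr, hrm⟩ : ∃ r > 0, r < min r₀ r₁ := exists_between (lt_min hr₀ hr₁)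
  have hsub : Metric.closedBall (0 : ℂ) r ⊆ Metric.ball 0 r₀ :=
    Metric.closedBall_subset_ball (hrm.trans_le (min_le_left _ _))
  obtain ⟨m, hm, hmS⟩ : ∃ m > 0, ∀ ζ ∈ Metric.sphere (0 : ℂ) r, m ≤ ‖J (p 0 ζ)‖ := by
    have hcont : ContinuousOn (fun ζ => ‖J (p 0 ζ)‖) (Metric.sphere (0 : ℂ) r) := by
      intro ζ hζ
      have h1 := hr₀U ζ (hsub (Metric.sphere_subset_closedBall hζ))
      refine (ContinuousAt.norm ?_).continuousWithinAt
      exact ContinuousAt.comp (g := J) (hJd _ h1).continuousAt (hslicec 0).continuousAt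
    obtain ⟨ζ, hζ, hmin⟩ := (isCompact_sphere (0 : ℂ) r).exists_isMinOn
      (NormedSpace.sphere_nonempty.2 hr.le) hcont
    refine ⟨_, norm_pos_iff.2 (hne ζ ?_ ?_), fun ζ' hζ' => hmin hζ'⟩
    · exact Metric.closedBall_subset_ball (hrm.trans_le (min_le_right _ _))
        (Metric.sphere_subset_closedBall hζ)
    · rintro rfl
      simp [hr.ne] at hζ
  have hev : ∀ᶠ η in 𝓝 (0 : ℂ), ∀ ζ ∈ Metric.closedBall (0 : ℂ) r,
      p η ζ ∈ U ∧ ‖J (p η ζ) - J (p 0 ζ)‖ < m / 2 := by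
    refine IsCompact.eventually_forall_of_forall_eventually
      (P := fun η ζ => p η ζ ∈ U ∧ ‖J (p η ζ) - J (p 0 ζ)‖ < m / 2)
      (isCompact_closedBall 0 r) fun ζ hζ => ?_
    have hζU := hr₀U ζ (hsub hζ)
    have hp1 : ContinuousAt (fun x : ℂ × ℂ => p x.1 x.2) (0, ζ) := hp.continuousAt
    have hp2 : ContinuousAt (fun x : ℂ × ℂ => p 0 x.2) (0, ζ) :=
      ((hslicec 0).comp continuous_snd).continuousAt
    have hc1 : ContinuousAt (fun x : ℂ × ℂ => J (p x.1 x.2)) (0, ζ) :=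
      ContinuousAt.comp (g := J) (f := fun x : ℂ × ℂ => p x.1 x.2) (hJd _ hζU).continuousAt hp1
    have hc2 : ContinuousAt (fun x : ℂ × ℂ => J (p 0 x.2)) (0, ζ) :=
      ContinuousAt.comp (g := J) (f := fun x : ℂ × ℂ => p 0 x.2) (hJd _ hζU).continuousAt hp2
    refine (hp1.eventually (hU.eventually_mem hζU)).and ?_
    have hc3 := (hc1.sub hc2).norm
    refine hc3.eventually (gt_mem_nhds ?_)
    simpa using hm
  have hev' : ∀ᶠ η in 𝓝[≠] (0 : ℂ), η ≠ 0 ∧ ∀ ζ ∈ Metric.closedBall (0 : ℂ) r,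
      p η ζ ∈ U ∧ ‖J (p η ζ) - J (p 0 ζ)‖ < m / 2 :=
    (eventually_mem_nhdsWithin (a := (0 : ℂ)) (s := {0}ᶜ)).and
      (hev.filter_mono nhdsWithin_le_nhds)
  obtain ⟨η, hη, hηr⟩ := hev'.exists
  by_contra! hno
  have hnz : ∀ ζ ∈ Metric.closedBall (0 : ℂ) r, J (p η ζ) ≠ 0 := by
    intro ζ hζ
    refine hno _ (hηr ζ hζ).1 fun heq => hη ?_
    have := congrArg (fun z : Cn 2 => z 1) heq
    simpa [p, he₀, he₁] using this
  have hdc : DiffContOnCl ℂ (fun ζ => J (p η ζ)) (Metric.ball 0 r) := by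
    refine DifferentiableOn.diffContOnCl fun ζ hζ => ?_
    rw [closure_ball _ hr.ne'] at hζ
    refine ((hJd _ (hηr ζ hζ).1).comp ζ ?_).differentiableWithinAt
    fun_prop
  have hinv := hdc.inv (by rw [closure_ball _ hr.ne']; exact hnz)
  have hle : ‖(fun ζ => J (p η ζ))⁻¹ 0‖ ≤ (m / 2)⁻¹ := by
    refine Complex.norm_le_of_forall_mem_frontier_norm_le Metric.isBounded_ball hinv ?_
      (subset_closure (Metric.mem_ball_self hr))
    intro ζ hζ
    rw [frontier_ball _ hr.ne'] at hζ
    rw [Pi.inv_apply, norm_inv]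
    have h1 := (hηr ζ (Metric.sphere_subset_closedBall hζ)).2
    have h2 := hmS ζ hζ
    have h3 := norm_sub_norm_le (J (p 0 ζ)) (J (p η ζ))
    rw [norm_sub_rev] at h3
    gcongr
    linarith
  have h1 := (hηr 0 (Metric.mem_closedBall_self hr.le)).2
  rw [hp0, h0, sub_zero] at h1
  rw [Pi.inv_apply, norm_inv] at hle
  have h2 := norm_pos_iff.2 (hnz 0 (Metric.mem_closedBall_self hr.le))
  have h3 := (inv_le_inv₀ h2 (by positivity)).1 hle
  linarith

/-- The Jacobian determinant of a map of two complex variables. -/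
noncomputable def jacobian (f : Cn 2 → Cn 2) (z : Cn 2) : ℂ :=
  fderiv ℂ f z (EuclideanSpace.single 0 1) 0 * fderiv ℂ f z (EuclideanSpace.single 1 1) 1 -
    fderiv ℂ f z (EuclideanSpace.single 0 1) 1 * fderiv ℂ f z (EuclideanSpace.single 1 1) 0

lemma exists_ker_of_jacobian_eq_zero {f : Cn 2 → Cn 2} {z : Cn 2} (h : jacobian f z = 0) :
    ∃ k ≠ 0, fderiv ℂ f z k = 0 := by
  set u := fderiv ℂ f z (EuclideanSpace.single 0 1) with hu
  set w := fderiv ℂ f z (EuclideanSpace.single 1 1) with hw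
  have hdet : u 0 * w 1 - u 1 * w 0 = 0 := h
  have happ : ∀ a b : ℂ, fderiv ℂ f z (a • EuclideanSpace.single 0 1 +
      b • EuclideanSpace.single 1 1) = a • u + b • w := by
    intro a b; rw [map_add, map_smul, map_smul]
  have hne : ∀ a b : ℂ, b ≠ 0 → a • EuclideanSpace.single (0 : Fin 2) (1 : ℂ) +
      b • EuclideanSpace.single (1 : Fin 2) (1 : ℂ) ≠ 0 := by
    intro a b hb h0
    have := congrArg (fun v : Cn 2 => v 1) h0
    simp at this
    exact hb this
  by_cases h0 : u 0 = 0
  · by_cases h1 : u 1 = 0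
    · refine ⟨EuclideanSpace.single 0 1, by simp, ?_⟩
      ext i; fin_cases i
      · exact h0
      · exact h1
    · refine ⟨_, hne (-w 1) (u 1) h1, ?_⟩
      rw [happ]
      ext i; fin_cases i
      · simp; linear_combination (-1 : ℂ) * hdet
      · simp; ring
  · refine ⟨_, hne (-w 0) (u 0) h0, ?_⟩
    rw [happ]
    ext i; fin_cases i
    · simp; ring
    · simp; linear_combination hdet

lemma differentiableOn_jacobian {f : Cn 2 → Cn 2} {U : Set (Cn 2)} (hU : IsOpen U)
    (hf : DifferentiableOn ℂ f U) : DifferentiableOn ℂ (jacobian f) U := by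
  have h : ∀ (v : Cn 2) (i : Fin 2), DifferentiableOn ℂ (fun z => fderiv ℂ f z v i) U :=
    fun v i z hz => ((EuclideanSpace.proj i : Cn 2 →L[ℂ] ℂ).differentiableAt.comp z
      (differentiableAt_fderiv_apply hU hf v hz)).differentiableWithinAt
  exact ((h _ _).mul (h _ _)).sub ((h _ _).mul (h _ _))

/-- The `m`-th derivative of `J` in the direction of the first coordinate. -/
noncomputable def iterPartial (J : Cn 2 → ℂ) : ℕ → Cn 2 → ℂ
  | 0 => J
  | m + 1 => fun z => fderiv ℂ (iterPartial J m) z (EuclideanSpace.single 0 1)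

lemma differentiableOn_iterPartial {J : Cn 2 → ℂ} {U : Set (Cn 2)} (hU : IsOpen U)
    (hJ : DifferentiableOn ℂ J U) (m : ℕ) : DifferentiableOn ℂ (iterPartial J m) U := by
  induction m with
  | zero => exact hJ
  | succ m ih => exact fun z hz =>
      (differentiableAt_fderiv_apply hU ih _ hz).differentiableWithinAt

lemma eventually_zero_of_iterPartial {J : Cn 2 → ℂ} {U : Set (Cn 2)} (hU : IsOpen U)
    (hJ : DifferentiableOn ℂ J U) {q : Cn 2} (hq : q ∈ U) (h : ∀ m, iterPartial J m q = 0) :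
    ∀ᶠ ζ in 𝓝 (0 : ℂ), J (q + ζ • EuclideanSpace.single 0 1) = 0 := by
  set e₀ : Cn 2 := EuclideanSpace.single 0 1 with he₀
  have hline : Continuous fun ζ : ℂ => q + ζ • e₀ := by fun_prop
  have hV : IsOpen ((fun ζ : ℂ => q + ζ • e₀) ⁻¹' U) := hU.preimage hline
  have h0V : (0 : ℂ) ∈ (fun ζ : ℂ => q + ζ • e₀) ⁻¹' U := by simpa using hq
  have hder : ∀ m, Set.EqOn (iteratedDeriv m fun ζ : ℂ => J (q + ζ • e₀))
      (fun ζ => iterPartial J m (q + ζ • e₀)) ((fun ζ : ℂ => q + ζ • e₀) ⁻¹' U) := by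
    intro m
    induction m with
    | zero => intro ζ _; simp [iterPartial]
    | succ m ih =>
      intro ζ hζ
      rw [iteratedDeriv_succ, (ih.eventuallyEq_of_mem (hV.mem_nhds hζ)).deriv_eq]
      have h1 := ((differentiableOn_iterPartial hU hJ m).differentiableAt
        (hU.mem_nhds hζ)).hasFDerivAt
      have h2 : HasDerivAt (fun ζ : ℂ => q + ζ • e₀) e₀ ζ := by
        simpa using ((hasDerivAt_id ζ).smul_const e₀).const_add q
      exact (h1.comp_hasDerivAt ζ h2).deriv
  obtain ⟨r, hr, hrV⟩ := Metric.isOpen_iff.1 hV 0 h0V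
  have hdiff : DifferentiableOn ℂ (fun ζ : ℂ => J (q + ζ • e₀)) (Metric.ball 0 r) := by
    intro ζ hζ
    refine ((hJ.differentiableAt (hU.mem_nhds (hrV hζ))).comp ζ ?_).differentiableWithinAt
    fun_prop
  filter_upwards [Metric.ball_mem_nhds 0 hr] with ζ hζ
  have hs := Complex.hasSum_taylorSeries_on_ball hdiff hζ
  have hz : ∀ m, iteratedDeriv m (fun ζ : ℂ => J (q + ζ • e₀)) 0 = 0 := by
    intro m
    rw [hder m h0V]
    simpa using h m
  simp only [hz, smul_zero] at hs
  exact hs.unique hasSum_zero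

/-- **Osgood's theorem** in two variables: an injective holomorphic map is locally biholomorphic.
At a zero of the Jacobian determinant `J` the whole derivative vanishes. At a zero of `J` where the
order of vanishing in the first variable is least, the zero set of `J` is a smooth curve, along
which the map would be constant. -/
theorem jacobian_ne_zero_of_injOn {f : Cn 2 → Cn 2} {U : Set (Cn 2)} (hU : IsOpen U)
    (hf : DifferentiableOn ℂ f U) (hi : Set.InjOn f U) {q₀ : Cn 2} (hq₀ : q₀ ∈ U) :
    jacobian f q₀ ≠ 0 := by
  intro hJ0
  have hJ := differentiableOn_jacobian hU hf
  have hzero : ∀ q ∈ U, jacobian f q = 0 → fderiv ℂ f q = 0 := by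
    intro q hq h
    obtain ⟨k, hk, hfk⟩ := exists_ker_of_jacobian_eq_zero h
    exact fderiv_eq_zero_of_injOn hU hf hi hq hk hfk
  -- A curve inside the zero set of the Jacobian is mapped to a point.
  have hcurve : ∀ (c : ℂ → Cn 2), c 0 ∈ U → (∀ᶠ x in 𝓝 0, DifferentiableAt ℂ c x) →
      (∀ᶠ x in 𝓝 0, jacobian f (c x) = 0) → ∀ᶠ x in 𝓝 0, c x = c 0 := by
    intro c hc0 hc hJc
    have hcU : ∀ᶠ x in 𝓝 (0 : ℂ), c x ∈ U :=
      hc.self_of_nhds.continuousAt.eventually (hU.eventually_mem hc0)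
    have h1 : ∀ᶠ x in 𝓝 (0 : ℂ), HasDerivAt (fun x => f (c x)) 0 x := by
      filter_upwards [hc, hJc, hcU] with x hx1 hx2 hx3
      have h2 := (hf.differentiableAt (hU.mem_nhds hx3)).hasFDerivAt
      rw [hzero _ hx3 hx2] at h2
      simpa using! h2.comp_hasDerivAt x hx1.hasDerivAt
    filter_upwards [eventually_eq_of_hasDerivAt_zero h1, hcU] with x hx hxU
    exact hi hxU hc0 hx
  -- The Jacobian does not vanish identically on a slice, as a line is not mapped to a point.
  have hfin : ∀ q ∈ U, jacobian f q = 0 → ∃ m, iterPartial (jacobian f) m q ≠ 0 := by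
    intro q hq h
    by_contra! hall
    have h1 := hcurve (fun ζ => q + ζ • EuclideanSpace.single 0 1) (by simpa using hq)
      (Eventually.of_forall fun x => by fun_prop)
      (eventually_zero_of_iterPartial hU hJ hq hall)
    have h2 : ∀ᶠ x in 𝓝 (0 : ℂ), x = 0 := by
      filter_upwards [h1] with x hx
      have := congrArg (fun v : Cn 2 => v 0) hx
      simpa using this
    obtain ⟨x, hx, hx0⟩ :=
      ((eventually_mem_nhdsWithin (a := (0 : ℂ)) (s := {0}ᶜ)).and
        (h2.filter_mono nhdsWithin_le_nhds)).exists
    exact hx hx0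
  classical
  have hex : ∃ m, ∃ q ∈ U, jacobian f q = 0 ∧ iterPartial (jacobian f) m q ≠ 0 := by
    obtain ⟨m, hm⟩ := hfin q₀ hq₀ hJ0
    exact ⟨m, q₀, hq₀, hJ0, hm⟩
  obtain ⟨q, hq, hJq, hDq⟩ := Nat.find_spec hex
  obtain ⟨m, hm⟩ : ∃ m, Nat.find hex = m + 1 := by
    refine Nat.exists_eq_succ_of_ne_zero fun h => ?_
    rw [h] at hDq
    exact hDq hJq
  rw [hm] at hDq
  have hmin : ∀ z ∈ U, jacobian f z = 0 → iterPartial (jacobian f) m z = 0 := by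
    intro z hz hJz
    by_contra hne
    exact Nat.find_min hex (m := m) (by omega) ⟨z, hz, hJz, hne⟩
  obtain ⟨c, ℓ, hc, hc0, -, hℓ, hℓq, hℓc, hlev, -⟩ :=
    exists_level_curve hU (differentiableOn_iterPartial hU hJ m) hq
      (fun h => hDq (by simp [iterPartial, h]))
  -- `c` parametrizes the zeros of the partial derivative of order `m`, among them those of the
  -- Jacobian, which accumulate at `q`.
  have hfreq : ∃ᶠ x in 𝓝[≠] (0 : ℂ), jacobian f (c x) = 0 := by
    rw [frequently_iff]
    intro S hS
    have hev : ∀ᶠ z in 𝓝 q, (ℓ z ≠ 0 → ℓ z ∈ S) ∧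
        (iterPartial (jacobian f) m z = iterPartial (jacobian f) m q → c (ℓ z) = z) := by
      refine Eventually.and ?_ hlev
      rw [mem_nhdsWithin_iff_eventually] at hS
      have := hℓ.continuousAt (x := q)
      rw [ContinuousAt, hℓq] at this
      filter_upwards [this.eventually hS] with z hz using hz
    obtain ⟨V, hVsub, hV, hqV⟩ := mem_nhds_iff.1 hev
    obtain ⟨z, ⟨hzU, hzV⟩, hzq, hJz⟩ := exists_zero_ne_of_zero (hU.inter hV)
      (hJ.mono Set.inter_subset_left) ⟨hq, hqV⟩ hJq
    obtain ⟨h1, h2⟩ := hVsub hzV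
    have hz := h2 (by rw [hmin z hzU hJz, hmin q hq hJq])
    refine ⟨ℓ z, h1 fun h0 => hzq ?_, by rw [hz]; exact hJz⟩
    rw [← hz, h0, hc0]
  have hcU : ∀ᶠ x in 𝓝 (0 : ℂ), c x ∈ U :=
    hc.self_of_nhds.continuousAt.eventually (by rw [hc0]; exact hU.eventually_mem hq)
  have hana : AnalyticAt ℂ (fun x => jacobian f (c x)) 0 := by
    rw [Complex.analyticAt_iff_eventually_differentiableAt]
    filter_upwards [hc, hcU] with x hx hxU
    exact (hJ.differentiableAt (hU.mem_nhds hxU)).comp x hx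
  have h1 := hcurve c (by rwa [hc0]) hc (hana.frequently_zero_iff_eventually_zero.1 hfreq)
  have h2 : ∀ᶠ x in 𝓝 (0 : ℂ), x = 0 := by
    filter_upwards [h1, hℓc] with x hx hx'
    rw [← hx', hx, hc0, hℓq]
  obtain ⟨x, hx, hx0⟩ :=
    ((eventually_mem_nhdsWithin (a := (0 : ℂ)) (s := {0}ᶜ)).and
      (h2.filter_mono nhdsWithin_le_nhds)).exists
  exact hx hx0

/-! ### Transition maps and the coefficient of a composition -/

lemma fderiv_injective_of_injOn {f : Cn 2 → Cn 2} {U : Set (Cn 2)} (hU : IsOpen U)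
    (hf : DifferentiableOn ℂ f U) (hi : Set.InjOn f U) {q : Cn 2} (hq : q ∈ U) :
    Function.Injective (fderiv ℂ f q) := by
  rw [injective_iff_map_eq_zero]
  intro k hk
  by_contra hne
  have h := fderiv_eq_zero_of_injOn hU hf hi hq hne hk
  exact jacobian_ne_zero_of_injOn hU hf hi hq (by simp [jacobian, h])

lemma isOpen_unitBall {n : ℕ} : IsOpen (unitBall n) := Metric.isOpen_ball

lemma zero_mem_unitBall {n : ℕ} : (0 : Cn n) ∈ unitBall n := Metric.mem_ball_self one_pos

lemma mem_unitBall {n : ℕ} {z : Cn n} : z ∈ unitBall n ↔ ‖z‖ < 1 := mem_ball_zero_iff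

/-- The transition map `g⁻¹ ∘ f` of univalent maps with `f(𝔹²) ⊆ g(𝔹²)`. -/
lemma exists_transition {f g : Cn 2 → Cn 2} (hf : IsUnivalent f) (hg : IsUnivalent g)
    (hsub : f '' unitBall 2 ⊆ g '' unitBall 2) (hf0 : f 0 = 0) (hg0 : g 0 = 0) :
    ∃ v : Cn 2 → Cn 2, DifferentiableOn ℂ v (unitBall 2) ∧
      Set.MapsTo v (unitBall 2) (unitBall 2) ∧ v 0 = 0 ∧ ∀ z ∈ unitBall 2, g (v z) = f z := by
  have hex : ∀ z ∈ unitBall 2, ∃ w ∈ unitBall 2, g w = f z := fun z hz =>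
    hsub (Set.mem_image_of_mem f hz)
  choose! v hv hgv using hex
  refine ⟨v, fun z hz => ?_, hv, ?_, hgv⟩
  · let A : Cn 2 ≃L[ℂ] Cn 2 := (LinearMap.linearEquivOfInjective
      (fderiv ℂ g (v z) : Cn 2 →L[ℂ] Cn 2).toLinearMap
      (fderiv_injective_of_injOn isOpen_unitBall hg.1 hg.2 (hv z hz)) rfl).toContinuousLinearEquiv
    have hA : (A : Cn 2 →L[ℂ] Cn 2) = fderiv ℂ g (v z) := by ext v; rfl
    have hstrict : HasStrictFDerivAt g (A : Cn 2 →L[ℂ] Cn 2) (v z) :=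
      hA ▸ hasStrictFDerivAt_of_differentiableOn isOpen_unitBall hg.1 (hv z hz)
    have hfz : DifferentiableAt ℂ f z := hf.1.differentiableAt (isOpen_unitBall.mem_nhds hz)
    have hinvD : DifferentiableAt ℂ (hstrict.localInverse g A (v z)) (f z) := by
      rw [← hgv z hz]
      exact hstrict.to_localInverse.hasFDerivAt.differentiableAt
    refine DifferentiableAt.differentiableWithinAt ((hinvD.comp z hfz).congr_of_eventuallyEq ?_)
    have h1 : ∀ᶠ y in 𝓝 (f z), g (hstrict.localInverse g A (v z) y) = y ∧
        hstrict.localInverse g A (v z) y ∈ unitBall 2 := by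
      rw [← hgv z hz]
      refine hstrict.eventually_right_inverse.and ?_
      refine hstrict.localInverse_continuousAt.eventually ?_
      rw [hstrict.localInverse_apply_image]
      exact isOpen_unitBall.eventually_mem (hv z hz)
    filter_upwards [hfz.continuousAt.eventually h1, isOpen_unitBall.mem_nhds hz] with x hx hxB
    exact hg.2 (hv x hxB) hx.2 ((hgv x hxB).trans hx.1.symm)
  · exact hg.2 (hv 0 zero_mem_unitBall) zero_mem_unitBall
      (by rw [hgv 0 zero_mem_unitBall, hf0, hg0])

/-- The second derivative at `0`, in the direction of the second coordinate, of the first component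
of `f`: twice the Taylor coefficient of `z₂²`. -/
noncomputable def secondCoeff (f : Cn 2 → Cn 2) : ℂ :=
  deriv (deriv fun w : ℂ => f (w • EuclideanSpace.single 1 1) 0) 0

lemma toLp_zero_eq_smul (w : ℂ) : (!₂[0, w] : Cn 2) = w • EuclideanSpace.single 1 1 := by
  ext i; fin_cases i <;> simp

lemma taylorCoeff_eq_secondCoeff (f : Cn 2 → Cn 2) : taylorCoeff f 0 0 2 = secondCoeff f / 2 := by
  simp only [taylorCoeff, secondCoeff, iteratedDeriv_zero, toLp_zero_eq_smul, iteratedDeriv_succ]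
  norm_num

/-- Second derivative of a holomorphic function along a holomorphic curve. -/
lemma deriv_deriv_comp_curve {F : Cn 2 → ℂ} {U : Set (Cn 2)} (hU : IsOpen U)
    (hF : DifferentiableOn ℂ F U) {γ : ℂ → Cn 2} (hγ : AnalyticAt ℂ γ 0) (h0 : γ 0 ∈ U) :
    deriv (deriv fun x => F (γ x)) 0 =
      fderiv ℂ (fderiv ℂ F) (γ 0) (deriv γ 0) (deriv γ 0) +
        fderiv ℂ F (γ 0) (deriv (deriv γ) 0) := by
  have hev : deriv (fun x => F (γ x)) =ᶠ[𝓝 0] fun x => fderiv ℂ F (γ x) (deriv γ x) := by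
    filter_upwards [hγ.eventually_analyticAt,
      hγ.continuousAt.eventually (hU.eventually_mem h0)] with x hx hxU
    exact ((hF.differentiableAt (hU.mem_nhds hxU)).hasFDerivAt.comp_hasDerivAt x
      hx.differentiableAt.hasDerivAt).deriv
  rw [hev.deriv_eq]
  have h1 : DifferentiableAt ℂ (fderiv ℂ F) (γ 0) :=
    (((contDiffOn_of_differentiableOn hU 2 hF).contDiffAt (hU.mem_nhds h0)).fderiv_right
      (m := 1) (by norm_num)).differentiableAt one_ne_zero
  have h2 := h1.hasFDerivAt.comp_hasDerivAt 0 hγ.differentiableAt.hasDerivAt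
  exact (h2.clm_apply hγ.deriv.differentiableAt.hasDerivAt).deriv

lemma differentiableOn_component {f : Cn 2 → Cn 2} {U : Set (Cn 2)}
    (hf : DifferentiableOn ℂ f U) (i : Fin 2) : DifferentiableOn ℂ (fun z => f z i) U :=
  fun z hz => (EuclideanSpace.proj i : Cn 2 →L[ℂ] ℂ).differentiableAt.comp_differentiableWithinAt
    z (hf z hz)

lemma deriv_component {γ : ℂ → Cn 2} {x : ℂ} (hγ : DifferentiableAt ℂ γ x) (i : Fin 2) :
    deriv (fun x => γ x i) x = deriv γ x i :=
  ((EuclideanSpace.proj i : Cn 2 →L[ℂ] ℂ).hasFDerivAt.comp_hasDerivAt x hγ.hasDerivAt).deriv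

lemma deriv_deriv_component {γ : ℂ → Cn 2} (hγ : AnalyticAt ℂ γ 0) (i : Fin 2) :
    deriv (deriv fun x => γ x i) 0 = deriv (deriv γ) 0 i := by
  have hev : (deriv fun x => γ x i) =ᶠ[𝓝 0] fun x => deriv γ x i := by
    filter_upwards [hγ.eventually_analyticAt] with x hx using deriv_component hx.differentiableAt i
  rw [hev.deriv_eq, deriv_component hγ.deriv.differentiableAt]

lemma hasDerivAt_smul_const (e : Cn 2) (x : ℂ) : HasDerivAt (fun w : ℂ => w • e) e x := by
  simpa using (hasDerivAt_id x).smul_const e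

lemma secondCoeff_eq_fderiv_fderiv {f : Cn 2 → Cn 2} (hf : DifferentiableOn ℂ f (unitBall 2)) :
    secondCoeff f = fderiv ℂ (fderiv ℂ fun z => f z 0) 0 (EuclideanSpace.single 1 1)
      (EuclideanSpace.single 1 1) := by
  have h1 : deriv (fun w : ℂ => w • (EuclideanSpace.single 1 1 : Cn 2)) =
      fun _ => EuclideanSpace.single 1 1 := funext fun x => (hasDerivAt_smul_const _ x).deriv
  have h := deriv_deriv_comp_curve isOpen_unitBall (differentiableOn_component hf 0)
    (γ := fun w : ℂ => w • EuclideanSpace.single 1 1) (by fun_prop)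
    (by simpa using zero_mem_unitBall)
  rw [h1] at h
  simpa [secondCoeff] using h

/-- The second coefficient of a composition of maps whose derivatives at `0` are scalar. -/
lemma secondCoeff_of_comp {f g v : Cn 2 → Cn 2} (hg : DifferentiableOn ℂ g (unitBall 2))
    (hv : DifferentiableOn ℂ v (unitBall 2)) (hv0 : v 0 = 0)
    (hgv : ∀ z ∈ unitBall 2, g (v z) = f z) {lam mu : ℂ}
    (hdv : fderiv ℂ v 0 = lam • ContinuousLinearMap.id ℂ (Cn 2))
    (hdg : fderiv ℂ g 0 = mu • ContinuousLinearMap.id ℂ (Cn 2)) :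
    secondCoeff f = lam ^ 2 * secondCoeff g + mu * secondCoeff v := by
  set e₁ : Cn 2 := EuclideanSpace.single 1 1 with he₁
  have hball : ∀ᶠ w in 𝓝 (0 : ℂ), w • e₁ ∈ unitBall 2 := by
    have : ContinuousAt (fun w : ℂ => w • e₁) 0 := by fun_prop
    exact this.eventually (isOpen_unitBall.eventually_mem (by simpa using zero_mem_unitBall))
  have hγ : AnalyticAt ℂ (fun w : ℂ => v (w • e₁)) 0 := by
    rw [Complex.analyticAt_iff_eventually_differentiableAt]
    filter_upwards [hball] with w hw
    exact (hv.differentiableAt (isOpen_unitBall.mem_nhds hw)).comp w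
      (hasDerivAt_smul_const e₁ w).differentiableAt
  have hγ1 : deriv (fun w : ℂ => v (w • e₁)) 0 = lam • e₁ := by
    have h1 : HasFDerivAt v (fderiv ℂ v 0) ((0 : ℂ) • e₁) := by
      rw [zero_smul]
      exact (hv.differentiableAt (isOpen_unitBall.mem_nhds zero_mem_unitBall)).hasFDerivAt
    have h2 := (h1.comp_hasDerivAt 0 (hasDerivAt_smul_const e₁ 0)).deriv
    rw [hdv] at h2
    exact h2
  have hγ0 : v ((0 : ℂ) • e₁) = 0 := by rw [zero_smul, hv0]
  have hev : (fun w : ℂ => f (w • e₁) 0) =ᶠ[𝓝 0] fun w => g (v (w • e₁)) 0 := by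
    filter_upwards [hball] with w hw
    rw [hgv _ hw]
  have hdg0 := (fderiv_component
    (hg.differentiableAt (isOpen_unitBall.mem_nhds zero_mem_unitBall)) 0).fderiv
  rw [secondCoeff_eq_fderiv_fderiv hg, secondCoeff, hev.deriv.deriv_eq,
    deriv_deriv_comp_curve isOpen_unitBall (differentiableOn_component hg 0) hγ
      (by rw [hγ0]; exact zero_mem_unitBall), hγ1, hγ0, hdg0, hdg, secondCoeff,
    deriv_deriv_component hγ]
  simp
  ring

/-! ### The coefficient estimate for self-maps of the ball -/

lemma deriv_deriv_id_mul {H : ℂ → ℂ} (hH : AnalyticAt ℂ H 0) :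
    deriv (deriv fun x => x * H x) 0 = 2 * deriv H 0 := by
  have hev : deriv (fun x => x * H x) =ᶠ[𝓝 0] fun x => H x + x * deriv H x := by
    filter_upwards [hH.eventually_analyticAt] with x hx
    refine Eq.trans ((hasDerivAt_id x).mul hx.differentiableAt.hasDerivAt).deriv ?_
    simp
  rw [hev.deriv_eq]
  have h := (hH.differentiableAt.hasDerivAt.add
    ((hasDerivAt_id (0 : ℂ)).mul hH.deriv.differentiableAt.hasDerivAt)).deriv
  refine Eq.trans h ?_
  simp; ring

/-- Along the curve `γ(ζ) = (A ζ², b ζ)`, the function `ζ² ⟪γ(ζ), v(γ(ζ))⟫` coincides on the unit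
circle with the holomorphic function `Ā v₁(γ(ζ)) + b ζ v₂(γ(ζ))`. The Schwarz lemma bounds the
former by `‖A‖² + b²`, and Cauchy's estimate for the second derivative of the latter at `0` is the
claim: the weights `2` and `1` single out the monomial `z₂²` of `v₁`. -/
lemma norm_weighted_secondCoeff_le {v : Cn 2 → Cn 2} (hv : DifferentiableOn ℂ v (unitBall 2))
    (hmaps : Set.MapsTo v (unitBall 2) (unitBall 2)) (hv0 : v 0 = 0) {lam : ℂ}
    (hdv : fderiv ℂ v 0 = lam • ContinuousLinearMap.id ℂ (Cn 2)) (A : ℂ) (b : ℝ)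
    (hAb : ‖A‖ ^ 2 + b ^ 2 < 1) :
    ‖2 * lam * ((‖A‖ ^ 2 + b ^ 2 : ℝ) : ℂ) + starRingEnd ℂ A * b ^ 2 * secondCoeff v‖ ≤
      2 * (‖A‖ ^ 2 + b ^ 2) := by
  set e₀ : Cn 2 := EuclideanSpace.single 0 1 with he₀
  set e₁ : Cn 2 := EuclideanSpace.single 1 1 with he₁
  set ρ : ℝ := ‖A‖ ^ 2 + b ^ 2 with hρ
  have hρ0 : 0 ≤ ρ := by positivity
  let γ : ℂ → Cn 2 := fun ζ => (A * ζ ^ 2) • e₀ + (b * ζ) • e₁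
  have hγD : ∀ ζ, HasDerivAt γ ((2 * A * ζ) • e₀ + (b : ℂ) • e₁) ζ := by
    intro ζ
    have h1 : HasDerivAt (fun ζ : ℂ => A * ζ ^ 2) (2 * A * ζ) ζ := by
      have := ((hasDerivAt_pow 2 ζ).const_mul A)
      convert! this using 1
      push_cast; ring
    have h2 : HasDerivAt (fun ζ : ℂ => (b : ℂ) * ζ) b ζ := by
      simpa using (hasDerivAt_id ζ).const_mul (b : ℂ)
    exact (h1.smul_const e₀).add (h2.smul_const e₁)
  have hγd : deriv γ = fun ζ => (2 * A * ζ) • e₀ + (b : ℂ) • e₁ := funext fun ζ => (hγD ζ).deriv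
  have hγdd : deriv (deriv γ) 0 = (2 * A) • e₀ := by
    rw [hγd]
    have h2 : HasDerivAt (fun ζ : ℂ => 2 * A * ζ) (2 * A) 0 := by
      simpa using (hasDerivAt_id (0 : ℂ)).const_mul (2 * A)
    exact ((h2.smul_const e₀).add_const _).deriv
  have hγ1 : deriv γ 0 = (b : ℂ) • e₁ := by rw [hγd]; simp
  have hγ0 : γ 0 = 0 := by simp [γ]
  have hγ_norm : ∀ ζ, ‖γ ζ‖ ^ 2 = ‖A‖ ^ 2 * ‖ζ‖ ^ 4 + b ^ 2 * ‖ζ‖ ^ 2 := by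
    intro ζ
    rw [EuclideanSpace.norm_sq_eq, Fin.sum_univ_two]
    simp [γ, e₀, e₁]
    rw [mul_pow |b|, sq_abs]
    ring
  have hγ_le : ∀ ζ : ℂ, ‖ζ‖ ≤ 1 → ‖γ ζ‖ ^ 2 ≤ ρ := by
    intro ζ hζ
    rw [hγ_norm]
    have h2 : ‖ζ‖ ^ 2 ≤ 1 := pow_le_one₀ (norm_nonneg _) hζ
    have h4 : ‖ζ‖ ^ 4 ≤ 1 := pow_le_one₀ (norm_nonneg _) hζ
    nlinarith [sq_nonneg ‖A‖, sq_nonneg b]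
  have hγB : ∀ ζ : ℂ, ‖ζ‖ ≤ 1 → γ ζ ∈ unitBall 2 := by
    intro ζ hζ
    rw [mem_unitBall]
    have := hγ_le ζ hζ
    nlinarith [norm_nonneg (γ ζ)]
  have hvγ : ∀ ζ : ℂ, ‖ζ‖ ≤ 1 → DifferentiableAt ℂ (fun ζ => v (γ ζ)) ζ := fun ζ hζ =>
    (hv.differentiableAt (isOpen_unitBall.mem_nhds (hγB ζ hζ))).comp ζ (hγD ζ).differentiableAt
  have hvγi : ∀ i : Fin 2, ∀ ζ : ℂ, ‖ζ‖ ≤ 1 → DifferentiableAt ℂ (fun ζ => v (γ ζ) i) ζ :=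
    fun i ζ hζ => (EuclideanSpace.proj i : Cn 2 →L[ℂ] ℂ).differentiableAt.comp ζ (hvγ ζ hζ)
  have hana : ∀ i : Fin 2, AnalyticAt ℂ (fun ζ => v (γ ζ) i) 0 := by
    intro i
    rw [Complex.analyticAt_iff_eventually_differentiableAt]
    filter_upwards [Metric.closedBall_mem_nhds (0 : ℂ) one_pos] with ζ hζ
    exact hvγi i ζ (by simpa using hζ)
  have hγana : AnalyticAt ℂ γ 0 := by
    rw [Complex.analyticAt_iff_eventually_differentiableAt]
    exact Eventually.of_forall fun ζ => (hγD ζ).differentiableAt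
  let G : ℂ → ℂ := fun ζ => starRingEnd ℂ A * v (γ ζ) 0 + b * (ζ * v (γ ζ) 1)
  have hGd : DiffContOnCl ℂ G (Metric.ball 0 1) := by
    refine DifferentiableOn.diffContOnCl fun ζ hζ => ?_
    rw [closure_ball _ one_ne_zero] at hζ
    have hζ1 : ‖ζ‖ ≤ 1 := by simpa using hζ
    exact (((hvγi 0 ζ hζ1).const_mul _).add
      ((differentiableAt_id.mul (hvγi 1 ζ hζ1)).const_mul _)).differentiableWithinAt
  have hGle : ∀ ζ ∈ Metric.sphere (0 : ℂ) 1, ‖G ζ‖ ≤ ρ := by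
    intro ζ hζ
    have hζ1 : ‖ζ‖ = 1 := by simpa using hζ
    set x : Cn 2 := A • e₀ + (b * starRingEnd ℂ ζ) • e₁ with hx
    have hxn : ‖x‖ ^ 2 = ρ := by
      rw [EuclideanSpace.norm_sq_eq, Fin.sum_univ_two]
      simp [hx, e₀, e₁, hζ1, hρ]
    -- `x = ζ̄² γ(ζ)`, as `ζ ζ̄ = 1`; the inner product is conjugate-linear in its first argument.
    have hG : G ζ = inner ℂ x (v (γ ζ)) := by
      rw [PiLp.inner_apply, Fin.sum_univ_two]
      simp [G, hx, e₀, e₁]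
      ring
    have hvn : ‖v (γ ζ)‖ ≤ ‖γ ζ‖ :=
      Complex.norm_le_norm_of_mapsTo_ball hv (hmaps.mono_right Metric.ball_subset_closedBall) hv0
        (mem_unitBall.1 (hγB ζ hζ1.le))
    have hγn := hγ_le ζ hζ1.le
    rw [hG]
    refine (norm_inner_le_norm x _).trans ?_
    have h1 : ‖x‖ = √ρ := by rw [← hxn, Real.sqrt_sq (norm_nonneg _)]
    have h2 : ‖γ ζ‖ ≤ √ρ := Real.le_sqrt_of_sq_le hγn
    calc ‖x‖ * ‖v (γ ζ)‖ ≤ √ρ * √ρ := by rw [h1]; gcongr; exact hvn.trans h2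
      _ = ρ := Real.mul_self_sqrt hρ0
  have hcauchy := Complex.norm_iteratedDeriv_le_of_forall_mem_sphere_norm_le 2 one_pos hGd hGle
  have hv0d := hv.differentiableAt (isOpen_unitBall.mem_nhds zero_mem_unitBall)
  have h0 : deriv (deriv fun ζ => v (γ ζ) 0) 0 = b ^ 2 * secondCoeff v + 2 * A * lam := by
    rw [secondCoeff_eq_fderiv_fderiv hv, deriv_deriv_comp_curve isOpen_unitBall
      (differentiableOn_component hv 0) hγana (by rw [hγ0]; exact zero_mem_unitBall),
      hγdd, hγ1, hγ0, (fderiv_component hv0d 0).fderiv, hdv]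
    simp [e₀, e₁]
    ring
  have h1 : deriv (fun ζ => v (γ ζ) 1) 0 = lam * b := by
    have hd : HasFDerivAt (fun z => v z 1)
        ((EuclideanSpace.proj 1 : Cn 2 →L[ℂ] ℂ).comp (fderiv ℂ v 0)) (γ 0) := by
      rw [hγ0]; exact fderiv_component hv0d 1
    have h2 := (hd.comp_hasDerivAt 0 (hγD 0)).deriv
    refine Eq.trans h2 ?_
    rw [hdv]
    simp [e₀, e₁]
  have hG2 : iteratedDeriv 2 G 0 =
      2 * lam * (ρ : ℂ) + starRingEnd ℂ A * b ^ 2 * secondCoeff v := by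
    rw [iteratedDeriv_succ, iteratedDeriv_one]
    have hx1 : AnalyticAt ℂ (fun ζ => ζ * v (γ ζ) 1) 0 := analyticAt_id.mul (hana 1)
    have hev : deriv G =ᶠ[𝓝 0] fun ζ => starRingEnd ℂ A * deriv (fun ζ => v (γ ζ) 0) ζ +
        b * deriv (fun ζ => ζ * v (γ ζ) 1) ζ := by
      filter_upwards [(hana 0).eventually_analyticAt, hx1.eventually_analyticAt] with ζ h0 h1
      exact ((h0.differentiableAt.hasDerivAt.const_mul _).add
        (h1.differentiableAt.hasDerivAt.const_mul _)).deriv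
    have hAA : (ρ : ℂ) = starRingEnd ℂ A * A + b ^ 2 := by
      rw [mul_comm, Complex.mul_conj, Complex.normSq_eq_norm_sq, hρ]; push_cast; ring
    rw [hev.deriv_eq, hAA]
    refine Eq.trans (((hana 0).deriv.differentiableAt.hasDerivAt.const_mul _).add
      (hx1.deriv.differentiableAt.hasDerivAt.const_mul _)).deriv ?_
    rw [h0, deriv_deriv_id_mul (hana 1), h1]
    ring
  rw [hG2] at hcauchy
  simpa using hcauchy

/-- Optimal choice in `norm_weighted_secondCoeff_le`: `a b²` is largest on `a² + b² = 1` at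
`a = 1/√3`, `b² = 2/3`, where its value is `2 / (3√3)`. -/
lemma norm_secondCoeff_le_of_self_map {v : Cn 2 → Cn 2}
    (hv : DifferentiableOn ℂ v (unitBall 2))
    (hmaps : Set.MapsTo v (unitBall 2) (unitBall 2)) (hv0 : v 0 = 0) {lam : ℝ}
    (hdv : fderiv ℂ v 0 = (lam : ℂ) • ContinuousLinearMap.id ℂ (Cn 2)) :
    ‖secondCoeff v‖ ≤ 3 * √3 * (1 - lam) := by
  set Q := secondCoeff v with hQ
  have h3 : √3 ^ 2 = 3 := Real.sq_sqrt (by norm_num)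
  have h3p : 0 < √3 := by positivity
  have hb : √(2 / 3) ^ 2 = 2 / 3 := Real.sq_sqrt (by norm_num)
  -- The phase of `A` is chosen so that the two terms of the estimate add up in modulus.
  obtain ⟨u, hu, huQ⟩ : ∃ u : ℂ, ‖u‖ = 1 ∧ starRingEnd ℂ u * Q = ‖Q‖ := by
    by_cases h : Q = 0
    · exact ⟨1, by simp, by simp [h]⟩
    · have hn : (‖Q‖ : ℂ) ≠ 0 := by simpa using h
      refine ⟨Q / ‖Q‖, by simp [h], ?_⟩
      rw [map_div₀, Complex.conj_ofReal, div_mul_eq_mul_div, mul_comm, Complex.mul_conj,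
        Complex.normSq_eq_norm_sq, div_eq_iff hn]
      push_cast; ring
  have key : ∀ s ∈ Set.Ioo (0 : ℝ) 1, s * ‖Q‖ ≤ 3 * √3 * (1 - lam) := by
    intro s hs
    have hA : ‖((s / √3 : ℝ) : ℂ) * u‖ = s / √3 := by
      rw [norm_mul, hu, mul_one, Complex.norm_real, Real.norm_of_nonneg (div_pos hs.1 h3p).le]
    have hsum : (s / √3) ^ 2 + (s * √(2 / 3)) ^ 2 = s ^ 2 := by
      rw [div_pow, mul_pow, h3, hb]; ring
    have h := norm_weighted_secondCoeff_le hv hmaps hv0 hdv (((s / √3 : ℝ) : ℂ) * u)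
      (s * √(2 / 3)) (by rw [hA, hsum]; nlinarith [hs.1, hs.2])
    rw [hA, hsum, ← hQ, map_mul, Complex.conj_ofReal] at h
    have hreal : 2 * (lam : ℂ) * ((s ^ 2 : ℝ) : ℂ) +
        ((s / √3 : ℝ) : ℂ) * starRingEnd ℂ u * ((s * √(2 / 3) : ℝ) : ℂ) ^ 2 * Q =
        ((2 * lam * s ^ 2 + s / √3 * (s ^ 2 * (2 / 3)) * ‖Q‖ : ℝ) : ℂ) := by
      have hb' : ((√(2 / 3) : ℝ) : ℂ) ^ 2 = ((2 / 3 : ℝ) : ℂ) := by rw [← Complex.ofReal_pow, hb]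
      have hbs : ((s * √(2 / 3) : ℝ) : ℂ) ^ 2 = ((s ^ 2 * (2 / 3) : ℝ) : ℂ) := by
        rw [Complex.ofReal_mul, mul_pow, hb']; push_cast; ring
      rw [hbs]
      calc _ = 2 * (lam : ℂ) * ((s ^ 2 : ℝ) : ℂ) +
          ((s / √3 : ℝ) : ℂ) * ((s ^ 2 * (2 / 3) : ℝ) : ℂ) * (starRingEnd ℂ u * Q) := by ring
        _ = _ := by rw [huQ]; push_cast; ring
    rw [hreal, Complex.norm_real] at h
    have h' := (le_abs_self _).trans h
    have hs2 : 0 < s ^ 2 := by have := hs.1; positivity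
    have h5 : s / √3 * (2 / 3) * ‖Q‖ ≤ 2 * (1 - lam) := by
      refine le_of_mul_le_mul_left ?_ hs2
      nlinarith
    have h6 : s * ‖Q‖ = 3 / 2 * √3 * (s / √3 * (2 / 3) * ‖Q‖) := by field_simp
    rw [h6]
    nlinarith
  refine le_of_tendsto (f := fun s : ℝ => s * ‖Q‖) (x := 𝓝[<] 1) ?_ ?_
  · have : Tendsto (fun s : ℝ => s * ‖Q‖) (𝓝 1) (𝓝 (1 * ‖Q‖)) :=
      (continuous_id.mul continuous_const).tendsto 1
    rw [one_mul] at this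
    exact this.mono_left nhdsWithin_le_nhds
  · filter_upwards [Ioo_mem_nhdsLT (zero_lt_one' ℝ)] with s hs using key s hs

/-! ### The coefficient along a Loewner chain -/

lemma secondCoeff_const_smul (f : Cn 2 → Cn 2) (c : ℂ) :
    secondCoeff (fun z => c • f z) = c * secondCoeff f := by
  simp only [secondCoeff, PiLp.smul_apply, smul_eq_mul, deriv_const_mul_field',
    deriv_const_mul_field]

/-- Cauchy's estimate on the disc of radius `1/2`. -/
lemma norm_secondCoeff_le_of_bounded {f : Cn 2 → Cn 2} (hf : DifferentiableOn ℂ f (unitBall 2))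
    {M : ℝ} (hM : ∀ z ∈ Metric.closedBall (0 : Cn 2) (1 / 2), ‖f z‖ ≤ M) :
    ‖secondCoeff f‖ ≤ 8 * M := by
  have hmem : ∀ w : ℂ, ‖w‖ ≤ 1 / 2 →
      w • (EuclideanSpace.single 1 1 : Cn 2) ∈ Metric.closedBall (0 : Cn 2) (1 / 2) := by
    intro w hw
    simpa [norm_smul] using hw
  have hd : DiffContOnCl ℂ (fun w : ℂ => f (w • EuclideanSpace.single 1 1) 0)
      (Metric.ball 0 (1 / 2)) := by
    refine DifferentiableOn.diffContOnCl fun w hw => ?_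
    rw [closure_ball _ (by norm_num)] at hw
    have h1 := Metric.closedBall_subset_ball (by norm_num : (1 / 2 : ℝ) < 1)
      (hmem w (by simpa using hw))
    exact (((differentiableOn_component hf 0).differentiableAt (isOpen_unitBall.mem_nhds h1)).comp w
      (hasDerivAt_smul_const _ w).differentiableAt).differentiableWithinAt
  have h := Complex.norm_iteratedDeriv_le_of_forall_mem_sphere_norm_le 2 (by norm_num) hd
    (C := M) (fun w hw => (PiLp.norm_apply_le _ 0).trans
      (hM _ (hmem w (by simpa using (mem_sphere_zero_iff_norm.1 hw).le))))
  rw [iteratedDeriv_succ, iteratedDeriv_one] at h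
  refine h.trans (le_of_eq ?_)
  norm_num
  ring

/-- One step of a Loewner chain: `f_s = f_t ∘ v` with a self-map `v` of the ball whose derivative at
`0` is `e^(s-t)`. -/
lemma norm_secondCoeff_step {F : ℝ → Cn 2 → Cn 2} (hF : IsNormalizedLoewnerChain F) {s t : ℝ}
    (hs : 0 ≤ s) (hst : s ≤ t) :
    ‖secondCoeff (F s)‖ ≤ Real.exp (s - t) ^ 2 * ‖secondCoeff (F t)‖ +
      Real.exp t * (3 * √3 * (1 - Real.exp (s - t))) := by
  have ht := hs.trans hst
  obtain ⟨v, hv, hmaps, hv0, hgv⟩ := exists_transition (hF.univalent s hs) (hF.univalent t ht)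
    (hF.image_subset s t hs hst) (hF.map_zero s hs) (hF.map_zero t ht)
  have hdv : fderiv ℂ v 0 = ((Real.exp (s - t) : ℝ) : ℂ) • ContinuousLinearMap.id ℂ (Cn 2) := by
    have h0 := isOpen_unitBall.mem_nhds (zero_mem_unitBall (n := 2))
    have h1 : HasFDerivAt (F t) (fderiv ℂ (F t) 0) (v 0) := by
      rw [hv0]; exact ((hF.univalent t ht).1.differentiableAt h0).hasFDerivAt
    have h2 := h1.comp 0 (hv.differentiableAt h0).hasFDerivAt
    have h3 : (F t ∘ v) =ᶠ[𝓝 0] F s := by filter_upwards [h0] with z hz using hgv z hz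
    have h4 := h2.fderiv
    rw [h3.fderiv_eq, hF.fderiv_zero s hs, hF.fderiv_zero t ht] at h4
    ext1 k
    have h5 := congrArg (fun L : Cn 2 →L[ℂ] Cn 2 => ((Real.exp (-t) : ℝ) : ℂ) • L k) h4
    simp only [ContinuousLinearMap.comp_apply, smul_apply,
      ContinuousLinearMap.id_apply, smul_smul, ← Complex.ofReal_mul, ← Real.exp_add] at h5
    rw [neg_add_cancel, Real.exp_zero, Complex.ofReal_one, one_smul] at h5
    rw [← h5]
    simp only [smul_apply, ContinuousLinearMap.id_apply]
    ring_nf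
  rw [secondCoeff_of_comp (hF.univalent t ht).1 hv hv0 hgv hdv (hF.fderiv_zero t ht)]
  refine (norm_add_le _ _).trans ?_
  rw [norm_mul, norm_mul, norm_pow, Complex.norm_real, Complex.norm_real,
    Real.norm_of_nonneg (Real.exp_pos _).le, Real.norm_of_nonneg (Real.exp_pos _).le]
  gcongr
  exact norm_secondCoeff_le_of_self_map hv hmaps hv0 hdv

/-- Iterating `norm_secondCoeff_step` along the times `0, δ, …, N δ`; the sum of the errors
telescopes. -/
lemma norm_secondCoeff_zero_le {F : ℝ → Cn 2 → Cn 2} (hF : IsNormalizedLoewnerChain F) {δ : ℝ}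
    (hδ : 0 < δ) (N : ℕ) :
    ‖secondCoeff (F 0)‖ ≤ Real.exp (-(N * δ)) ^ 2 * ‖secondCoeff (F (N * δ))‖ +
      3 * √3 * Real.exp δ * (1 - Real.exp (-(N * δ))) := by
  induction N with
  | zero => simp
  | succ N ih =>
    have hN : 0 ≤ (N : ℝ) * δ := by positivity
    have h := norm_secondCoeff_step hF hN (t := (N + 1 : ℕ) * δ) (by push_cast; nlinarith)
    set x := ‖secondCoeff (F ((N + 1 : ℕ) * δ))‖
    refine ih.trans ?_
    have e1 : Real.exp (N * δ - (N + 1 : ℕ) * δ) = (Real.exp δ)⁻¹ := by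
      rw [← Real.exp_neg]; congr 1; push_cast; ring
    have e2 : Real.exp ((N + 1 : ℕ) * δ) = (Real.exp (-(N * δ)))⁻¹ * Real.exp δ := by
      rw [← Real.exp_neg, ← Real.exp_add]; congr 1; push_cast; ring
    have e3 : Real.exp (-((N + 1 : ℕ) * δ)) = Real.exp (-(N * δ)) * (Real.exp δ)⁻¹ := by
      rw [← Real.exp_neg δ, ← Real.exp_add]; congr 1; push_cast; ring
    rw [e1, e2] at h
    rw [e3]
    have hp := Real.exp_pos (-(N * δ))
    have hq := Real.exp_pos δ
    set p := Real.exp (-(N * δ))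
    set q := Real.exp δ
    calc p ^ 2 * ‖secondCoeff (F (N * δ))‖ + 3 * √3 * q * (1 - p)
        ≤ p ^ 2 * (q⁻¹ ^ 2 * x + p⁻¹ * q * (3 * √3 * (1 - q⁻¹))) + 3 * √3 * q * (1 - p) := by
          gcongr
      _ = _ := by field_simp; ring

/-- Normality bounds `e⁻ᵗ secondCoeff (F t)` along a sequence of multiples `t` of the step `δ`, so
the first term of `norm_secondCoeff_zero_le` disappears as `t → ∞`; then `δ → 0`. -/
theorem norm_secondCoeff_le_of_chain {F : ℝ → Cn 2 → Cn 2} (hF : IsNormalLoewnerChain F) :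
    ‖secondCoeff (F 0)‖ ≤ 3 * √3 := by
  have key : ∀ δ : ℝ, 0 < δ → ‖secondCoeff (F 0)‖ ≤ 3 * √3 * Real.exp δ := by
    intro δ hδ
    obtain ⟨φ, hφ, h, hconv⟩ := hF.normal (fun k => k * δ) (fun k => by positivity)
    set K : Set (Cn 2) := Metric.closedBall 0 (1 / 2) with hK
    have hKB : K ⊆ unitBall 2 := Metric.closedBall_subset_ball (by norm_num)
    have hKc : IsCompact K := isCompact_closedBall _ _
    have hunif := Metric.tendstoUniformlyOn_iff.1 (hconv K hKB hKc) 1 one_pos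
    set g : ℕ → Cn 2 → Cn 2 := fun k z => (Real.exp (-(φ k * δ)) : ℂ) • F (φ k * δ) z with hg
    have hFd : ∀ k, DifferentiableOn ℂ (F (φ k * δ)) (unitBall 2) := fun k =>
      (hF.univalent _ (by positivity)).1
    have hgd : ∀ k, DifferentiableOn ℂ (g k) (unitBall 2) := fun k =>
      (hFd k).const_smul (Real.exp (-(φ k * δ)) : ℂ)
    obtain ⟨k₀, hk₀⟩ := eventually_atTop.1 hunif
    obtain ⟨B, hB⟩ := hKc.exists_bound_of_continuousOn ((hgd k₀).continuousOn.mono hKB)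
    have hbound : ∀ k ≥ k₀, ∀ z ∈ K, ‖g k z‖ ≤ B + 2 := by
      intro k hk z hz
      have h1 : dist (h z) (g k z) < 1 := hk₀ k hk z hz
      have h2 : dist (h z) (g k₀ z) < 1 := hk₀ k₀ le_rfl z hz
      have h3 := hB z hz
      have h4 := dist_triangle_left (g k z) (g k₀ z) (h z)
      rw [dist_eq_norm] at h4
      have h5 := norm_sub_norm_le (g k z) (g k₀ z)
      linarith
    have hle : ∀ k ≥ k₀, ‖secondCoeff (F 0)‖ ≤
        Real.exp (-(φ k * δ)) * (8 * (B + 2)) + 3 * √3 * Real.exp δ := by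
      intro k hk
      have h1 := norm_secondCoeff_le_of_bounded (hgd k) (hbound k hk)
      have h2 := secondCoeff_const_smul (F (φ k * δ)) (Real.exp (-(φ k * δ)) : ℂ)
      have hp := Real.exp_pos (-(φ k * δ))
      change secondCoeff (g k) = _ at h2
      rw [h2, norm_mul, Complex.norm_real, Real.norm_of_nonneg hp.le] at h1
      have h3 := norm_secondCoeff_zero_le hF.toIsNormalizedLoewnerChain hδ (φ k)
      have h4 : 0 ≤ 3 * √3 * Real.exp δ * Real.exp (-(φ k * δ)) := by positivity
      have h5 := mul_le_mul_of_nonneg_left h1 hp.le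
      nlinarith
    have hlim : Tendsto (fun k => Real.exp (-(φ k * δ)) * (8 * (B + 2)) + 3 * √3 * Real.exp δ)
        atTop (𝓝 (0 * (8 * (B + 2)) + 3 * √3 * Real.exp δ)) := by
      refine ((Real.tendsto_exp_neg_atTop_nhds_zero.comp ?_).mul_const _).add_const _
      exact (tendsto_natCast_atTop_atTop.comp hφ.tendsto_atTop).atTop_mul_const hδ
    rw [zero_mul, zero_add] at hlim
    exact ge_of_tendsto hlim (eventually_atTop.2 ⟨k₀, hle⟩)
  have hlim : Tendsto (fun δ => 3 * √3 * Real.exp δ) (𝓝[>] 0) (𝓝 (3 * √3 * Real.exp 0)) :=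
    ((continuous_const.mul Real.continuous_exp).tendsto 0).mono_left nhdsWithin_le_nhds
  rw [Real.exp_zero, mul_one] at hlim
  refine ge_of_tendsto hlim ?_
  filter_upwards [self_mem_nhdsWithin] with δ hδ using key δ hδ

/-! ### Power series coefficients -/

/-- The power series coefficient of `z₂²` is the Taylor coefficient defined by derivatives. -/
lemma HasFirstComponent.coeff_eq {f : Cn 2 → Cn 2} {a : ℕ × ℕ → ℂ} (h : HasFirstComponent f a) :
    a (0, 2) = taylorCoeff f 0 0 2 := by
  set b : ℕ → ℂ := fun n => if n < 2 then 0 else a (0, n) with hb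
  let p : FormalMultilinearSeries ℂ ℂ ℂ := FormalMultilinearSeries.ofScalars ℂ b
  have hp : HasFPowerSeriesAt (fun w : ℂ => f (w • EuclideanSpace.single 1 1) 0) p 0 := by
    rw [hasFPowerSeriesAt_iff]
    filter_upwards [Metric.ball_mem_nhds (0 : ℂ) one_pos] with w hw
    have hs := h (w • EuclideanSpace.single 1 1) (by
      rw [mem_unitBall, norm_smul]; simpa using hw)
    -- On the axis `z₁ = 0` only the terms with `α = (0, n + 2)` survive.
    let j : ℕ → {α : ℕ × ℕ // 2 ≤ α.1 + α.2} := fun n => ⟨(0, n + 2), by simp⟩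
    have hj : Function.Injective j := fun m n hmn => by simpa [j] using hmn
    rw [← hj.hasSum_iff] at hs
    · rw [zero_add, ← hasSum_nat_add_iff' 2]
      convert! hs using 1
      · funext n
        simp [p, hb, j, mul_comm]
      · simp [p, hb, Finset.sum_range_succ]
    · rintro ⟨⟨m, n⟩, hmn⟩ hx
      have hm : m ≠ 0 := by
        rintro rfl
        refine hx ⟨n - 2, ?_⟩
        simp only [j, Subtype.mk.injEq, Prod.mk.injEq, true_and]
        simp only at hmn
        omega
      simp [hm]
  have h2 := (hp.analyticAt.hasFPowerSeriesAt).eq_formalMultilinearSeries hp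
  have h3 := congrArg (fun q : FormalMultilinearSeries ℂ ℂ ℂ => q.coeff 2) h2
  simp only [p, FormalMultilinearSeries.coeff_ofScalars] at h3
  rw [taylorCoeff_eq_secondCoeff, secondCoeff]
  rw [iteratedDeriv_succ, iteratedDeriv_one] at h3
  rw [show a (0, 2) = b 2 by simp [hb], ← h3]
  norm_num

/-! ### The extremal shear -/

/-- The worst case of `shear_polynomial_le`, at `X = 1 - d`. -/
lemma quartic_nonneg {d m : ℝ} (hd : 0 ≤ d) (hd1 : d ≤ 1) (hm : 0 ≤ m) (hm1 : m ≤ 1) :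
    0 ≤ m ^ 2 * (4 - 3 * m) + (1 - m) ^ 2 * (d ^ 2 * (3 - d) - m * d * (6 - 9 / 4 * d ^ 2)) := by
  nlinarith [mul_nonneg hd hm, mul_nonneg hd (sub_nonneg.2 hm1), mul_nonneg hm (sub_nonneg.2 hd1),
    mul_nonneg (sub_nonneg.2 hd1) (sub_nonneg.2 hm1), sq_nonneg (m - d), sq_nonneg (m * d),
    sq_nonneg (m * (1 - m)), sq_nonneg ((1 - m) * d), sq_nonneg (m - (1 - m) * d),
    sq_nonneg (m - (1 - m) * d * 3 / 4)]

/-- There is equality to second order in `m` at `X = 1`, the point where the coefficient estimate is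
sharp, so the expression is expanded around it. -/
lemma shear_polynomial_le {X m : ℝ} (hX : 0 ≤ X) (hX3 : X ^ 2 ≤ 3) (hm : 0 ≤ m) (hm1 : m ≤ 1) :
    (1 - m) ^ 2 * (3 + 3 * m * (X * (3 - X ^ 2)) + 9 / 4 * m ^ 2 * (3 - X ^ 2) ^ 2) ≤ 3 := by
  set e := X - 1 with he
  have hXe : X = 1 + e := by rw [he]; ring
  have hD : 0 ≤ m ^ 2 * (4 - 3 * m) +
      (1 - m) ^ 2 * (e ^ 2 * (3 + e) + m * (e * (6 - 3 * e ^ 2 - 3 / 4 * e ^ 3))) := by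
    rcases le_total 0 e with h0 | h0
    · have he1 : e ≤ 3 / 4 := by nlinarith
      have h1 : 0 ≤ 6 - 3 * e ^ 2 - 3 / 4 * e ^ 3 := by
        have h2 : e ^ 2 ≤ (3 / 4) ^ 2 := by gcongr
        have h3 : e ^ 3 ≤ (3 / 4) ^ 3 := by gcongr
        linarith
      have h2 : 0 ≤ 4 - 3 * m := by linarith
      positivity
    · have hd : 0 ≤ -e := by linarith
      have hd1 : -e ≤ 1 := by rw [hXe] at hX; linarith
      have h1 := quartic_nonneg hd hd1 hm hm1
      have h2 : 0 ≤ (1 - m) ^ 2 * (m * (3 / 4 * ((-e) ^ 3 * (1 - -e)))) := by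
        have : 0 ≤ 1 - -e := by linarith
        positivity
      nlinarith
  have hid : 3 - (1 - m) ^ 2 * (3 + 3 * m * (X * (3 - X ^ 2)) + 9 / 4 * m ^ 2 * (3 - X ^ 2) ^ 2) =
      3 * m * (m ^ 2 * (4 - 3 * m) +
        (1 - m) ^ 2 * (e ^ 2 * (3 + e) + m * (e * (6 - 3 * e ^ 2 - 3 / 4 * e ^ 3)))) := by
    rw [hXe]; ring
  have : 0 ≤ 3 * m * (m ^ 2 * (4 - 3 * m) +
        (1 - m) ^ 2 * (e ^ 2 * (3 + e) + m * (e * (6 - 3 * e ^ 2 - 3 / 4 * e ^ 3)))) := by positivity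
  linarith

/-- The conjugate `Φ⁻¹ ∘ (λ • ·) ∘ Φ` of a dilation by the shear `Φ` maps the ball to itself. -/
lemma shear_transition_mem {z : Cn 2} (hz : z ∈ unitBall 2) {lam : ℝ} (h0 : 0 < lam)
    (h1 : lam ≤ 1) :
    (!₂[(lam : ℂ) * z 0 + ((3 * √3 / 2 : ℝ) : ℂ) * lam * (1 - lam) * z 1 ^ 2, lam * z 1] : Cn 2) ∈
      unitBall 2 := by
  have hzn : ‖z 0‖ ^ 2 + ‖z 1‖ ^ 2 < 1 := by
    have h2 := mem_unitBall.1 hz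
    rw [← Fin.sum_univ_two (fun i => ‖z i‖ ^ 2), ← EuclideanSpace.norm_sq_eq]
    nlinarith [norm_nonneg z]
  set x := ‖z 0‖
  set y := ‖z 1‖
  have hx : 0 ≤ x := norm_nonneg _
  have hm : 0 ≤ 1 - lam := by linarith
  have h3 : √3 ^ 2 = 3 := Real.sq_sqrt (by norm_num)
  have hw0 : ‖(lam : ℂ) * z 0 + ((3 * √3 / 2 : ℝ) : ℂ) * lam * (1 - lam) * z 1 ^ 2‖ ≤
      lam * (x + 3 * √3 / 2 * (1 - lam) * y ^ 2) := by
    refine (norm_add_le _ _).trans (le_of_eq ?_)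
    have hc : ((1 : ℂ) - lam) = ((1 - lam : ℝ) : ℂ) := by push_cast; rfl
    rw [hc, norm_mul, norm_mul, norm_mul, norm_mul, norm_pow, Complex.norm_real, Complex.norm_real,
      Complex.norm_real, Real.norm_of_nonneg h0.le, Real.norm_of_nonneg hm,
      Real.norm_of_nonneg (by positivity)]
    ring
  have hw1 : ‖(lam : ℂ) * z 1‖ = lam * y := by
    rw [norm_mul, Complex.norm_real, Real.norm_of_nonneg h0.le]
  -- The case of equality `y² = 1 - x²` is the polynomial inequality for `X = √3 x`.
  have hpoly : lam ^ 2 * ((x + 3 * √3 / 2 * (1 - lam) * (1 - x ^ 2)) ^ 2 + (1 - x ^ 2)) ≤ 1 := by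
    have h := shear_polynomial_le (X := √3 * x) (m := 1 - lam) (by positivity)
      (by rw [mul_pow, h3]; nlinarith [sq_nonneg y]) hm (by linarith)
    have hX : (√3 * x) ^ 2 = 3 * x ^ 2 := by rw [mul_pow, h3]
    rw [hX] at h
    have hexp : (x + 3 * √3 / 2 * (1 - lam) * (1 - x ^ 2)) ^ 2 = x ^ 2 +
        3 * √3 * x * (1 - lam) * (1 - x ^ 2) + 27 / 4 * (1 - lam) ^ 2 * (1 - x ^ 2) ^ 2 := by
      linear_combination (9 / 4 * (1 - lam) ^ 2 * (1 - x ^ 2) ^ 2) * h3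
    rw [hexp]
    nlinarith
  rw [mem_unitBall]
  have hnorm : ‖(!₂[(lam : ℂ) * z 0 + ((3 * √3 / 2 : ℝ) : ℂ) * lam * (1 - lam) * z 1 ^ 2,
      lam * z 1] : Cn 2)‖ ^ 2 < 1 := by
    rw [EuclideanSpace.norm_sq_eq, Fin.sum_univ_two]
    change ‖(lam : ℂ) * z 0 + ((3 * √3 / 2 : ℝ) : ℂ) * lam * (1 - lam) * z 1 ^ 2‖ ^ 2 +
      ‖(lam : ℂ) * z 1‖ ^ 2 < 1
    rw [hw1]
    have hy : y ^ 2 < 1 - x ^ 2 := by linarith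
    calc _ ≤ (lam * (x + 3 * √3 / 2 * (1 - lam) * y ^ 2)) ^ 2 + (lam * y) ^ 2 := by gcongr
      _ = lam ^ 2 * ((x + 3 * √3 / 2 * (1 - lam) * y ^ 2) ^ 2 + y ^ 2) := by ring
      _ < lam ^ 2 * ((x + 3 * √3 / 2 * (1 - lam) * (1 - x ^ 2)) ^ 2 + (1 - x ^ 2)) := by
        have : (x + 3 * √3 / 2 * (1 - lam) * y ^ 2) ^ 2 ≤
            (x + 3 * √3 / 2 * (1 - lam) * (1 - x ^ 2)) ^ 2 := by gcongr
        exact mul_lt_mul_of_pos_left (by linarith) (by positivity)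
      _ ≤ 1 := hpoly
  nlinarith [norm_nonneg (!₂[(lam : ℂ) * z 0 + ((3 * √3 / 2 : ℝ) : ℂ) * lam * (1 - lam) * z 1 ^ 2,
      lam * z 1] : Cn 2)]

lemma hasFDerivAt_coord (i : Fin 2) (z : Cn 2) :
    HasFDerivAt (fun z : Cn 2 => z i) (EuclideanSpace.proj i : Cn 2 →L[ℂ] ℂ) z :=
  (EuclideanSpace.proj i : Cn 2 →L[ℂ] ℂ).hasFDerivAt

lemma shear_eq (z : Cn 2) : shear z =
    z + (((3 * √3 / 2 : ℝ) : ℂ) * z 1 ^ 2) • (EuclideanSpace.single 0 1 : Cn 2) := by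
  ext i; fin_cases i <;> simp [shear]

lemma differentiable_shear : Differentiable ℂ shear := by
  rw [funext shear_eq]
  fun_prop

lemma shear_zero : shear 0 = 0 := by simp [shear_eq]

lemma fderiv_shear_zero : fderiv ℂ shear 0 = ContinuousLinearMap.id ℂ (Cn 2) := by
  have h : HasFDerivAt (fun z : Cn 2 => z + (((3 * √3 / 2 : ℝ) : ℂ) * z 1 ^ 2) •
      (EuclideanSpace.single 0 1 : Cn 2)) _ 0 :=
    (hasFDerivAt_id 0).add ((((hasFDerivAt_coord 1 0).pow 2).const_mul _).smul_const _)
  rw [funext shear_eq]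
  rw [h.fderiv]
  ext v i
  simp

lemma injective_shear : Function.Injective shear := by
  intro z w h
  have h1 : shear z 1 = shear w 1 := by rw [h]
  have h0 : shear z 0 = shear w 0 := by rw [h]
  change z 1 = w 1 at h1
  change z 0 + ((3 * √3 / 2 : ℝ) : ℂ) * z 1 ^ 2 = w 0 + ((3 * √3 / 2 : ℝ) : ℂ) * w 1 ^ 2 at h0
  rw [h1, add_left_inj] at h0
  ext i; fin_cases i
  · exact h0
  · exact h1

/-- The shear is starlike: its dilations `eᵗ Φ` form a normal Loewner chain. -/
theorem shear_mem_S0 : shear ∈ S0 2 := by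
  refine ⟨fun t z => (Real.exp t : ℂ) • shear z, ⟨⟨?_, ?_, ?_, ?_⟩, ?_⟩, ?_⟩
  · intro t _
    refine ⟨(differentiable_shear.const_smul (Real.exp t : ℂ)).differentiableOn, ?_⟩
    intro z _ w _ h
    have : ((Real.exp t : ℝ) : ℂ) ≠ 0 := by exact_mod_cast (Real.exp_pos t).ne'
    exact injective_shear (smul_right_injective _ this h)
  · rintro s t _ hst _ ⟨z, hz, rfl⟩
    refine ⟨_, shear_transition_mem hz (Real.exp_pos (s - t)) (Real.exp_le_one_iff.2 (by linarith)),
      ?_⟩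
    have hexp : ((Real.exp s : ℝ) : ℂ) = (Real.exp t : ℝ) * (Real.exp (s - t) : ℝ) := by
      rw [← Complex.ofReal_mul, ← Real.exp_add]; congr 2; ring
    simp only [hexp]
    ext i; fin_cases i
    · simp [shear]; ring
    · simp [shear]; ring
  · intro t _
    simp [shear_zero]
  · intro t _
    have := (differentiable_shear.differentiableAt (x := 0)).hasFDerivAt.const_smul
      (Real.exp t : ℂ)
    rw [fderiv_shear_zero] at this
    exact this.fderiv
  · intro u _
    refine ⟨id, strictMono_id, shear, fun K _ _ => ?_⟩
    have : ∀ t z, (Real.exp (-t) : ℂ) • ((Real.exp t : ℂ) • shear z) = shear z := by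
      intro t z
      rw [smul_smul, ← Complex.ofReal_mul, ← Real.exp_add]
      simp
    simp only [this]
    rw [Metric.tendstoUniformlyOn_iff]
    intro ε hε
    exact Eventually.of_forall fun n z _ => by simpa using hε
  · funext z
    simp

lemma hasFirstComponent_shear : HasFirstComponent shear
    (fun α => if α = (0, 2) then ((3 * √3 / 2 : ℝ) : ℂ) else 0) := by
  intro z _
  have h := hasSum_single (f := fun α : {α : ℕ × ℕ // 2 ≤ α.1 + α.2} =>
    (if α.1 = (0, 2) then ((3 * √3 / 2 : ℝ) : ℂ) else 0) * (z 0 ^ α.1.1 * z 1 ^ α.1.2))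
    ⟨(0, 2), by norm_num⟩ (by
      intro α hα
      rw [if_neg fun h => hα (Subtype.ext h), zero_mul])
  convert! h using 1
  simp [shear]

end Loewner

theorem theorem3p1 :
    (∀ f ∈ Loewner.S0 2,
      ‖Loewner.taylorCoeff f 0 0 2‖ ≤ 3 * √3 / 2 ∧
      ∀ a : ℕ × ℕ → ℂ, Loewner.HasFirstComponent f a → ‖a (0, 2)‖ ≤ 3 * √3 / 2) ∧
    Loewner.shear ∈ Loewner.S0 2 ∧
    Loewner.taylorCoeff Loewner.shear 0 0 2 = ((3 * √3 / 2 : ℝ) : ℂ) ∧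
    ∃ a : ℕ × ℕ → ℂ, Loewner.HasFirstComponent Loewner.shear a ∧
      a (0, 2) = ((3 * √3 / 2 : ℝ) : ℂ) := by
  have hbound : ∀ f ∈ Loewner.S0 2, ‖Loewner.taylorCoeff f 0 0 2‖ ≤ 3 * √3 / 2 := by
    rintro _ ⟨F, hF, rfl⟩
    have h := Loewner.norm_secondCoeff_le_of_chain hF
    rw [Loewner.taylorCoeff_eq_secondCoeff, norm_div, Complex.norm_ofNat]
    linarith
  refine ⟨fun f hf => ⟨hbound f hf, fun a ha => ?_⟩, Loewner.shear_mem_S0, ?_, _,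
    Loewner.hasFirstComponent_shear, if_pos rfl⟩
  · rw [ha.coeff_eq]
    exact hbound f hf
  · rw [← Loewner.hasFirstComponent_shear.coeff_eq, if_pos rfl]
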